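/- Let $N,n\ge 0$ be integers and let $\mathcal W_n$ be the set of words of length $n$ without repeated letter in the alphabet $\{1,\dots,N\}$. **D$_0$ graphs.** A D$_0$ graph of degree $n$ is a graph on a vertex set $W\subseteq\mathcal W_n$ with edges colored from $\{2,\dots,n-1\}$ such that, for every $i$: (i) each $i$-edge is one of the pairs $\{v\,bac\,w,\;v\,bca\,w\}$, $\{v\,acb\,w,\;v\,cab\,w\}$, $\{v\,bac\,w,\;v\,acb\,w\}$, $\{v\,bca\,w,\;v\,cab\,w\}$ for some letters $a<b<c$ and words $v,w$ with $|v|=i-2$; (ii) for all letters $a<b<c$ and words $v,w$ with $|v|=i-2$, each element of $W\cap\{v\,bac\,w,\;v\,bca\,w,\;v\,acb\,w,\;v\,cab\,w\}$ belongs to exactly one $i$-edge. **Signed, colored graphs.** A signed, colored graph of degree $n$ is a finite graph $\mathcal G$ with vertex set $V$ and edges colored from $\{2,\dots,n-1\}$ (for each color a simple graph), together with a signature $\sigma:V\to\{+1,-1\}^{n-1}$. A D$_0$ graph is regarded as one by $\sigma(w)_i=+1$ if $w_i\le w_{i+1}$ and $\sigma(w)_i=-1$ if $w_i>w_{i+1}$.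 A vertex $v$ admits an $i$-neighbor if it is on some $i$-edge; if $v$ is on exactly one $i$-edge $\{v,w\}$, write $E_i(v)=w$. For an interval $K=\{a,\dots,a+d-1\}\subseteq\{1,\dots,n\}$, the restriction $\mathrm{Res}_K\mathcal G$ is the signed, colored graph of degree $d$ on the same vertices whose $s$-edges are the $(s+a-1)$-edges of $\mathcal G$ ($2\le s\le d-1$) and whose signature is $(\sigma(v)_a,\dots,\sigma(v)_{a+d-2})$; $\mathrm{Res}_K(\mathcal G,w)$ is its connected component containing $w$. The generating function of (a component of) a signed, colored graph of degree $n$ is the sum over its vertices $v$ of Gessel's fundamental quasisymmetric function $$Q_{\mathrm{Des}(v)}(\mathbf x)=\sum_{\substack{1\le i_1\le\cdots\le i_n\\ j\in\mathrm{Des}(v)\Rightarrow i_j<i_{j+1}}}x_{i_1}\cdots x_{i_n},\qquad \mathrm{Des}(v)=\{j:\sigma(v)_j=-1\}.$$ $\mathcal G$ is locally Schur positive for degree $d$ ($\mathrm{LSP}_d$) if for every interval $K\subseteq\{1,\dots,n\}$ of size $d$ the generating function of each connected component of $\mathrm{Res}_K\mathcal G$ is a nonnegative integer combination of Schur functions.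 **Axioms.** Conditions that involve a coordinate of $\sigma$ outside $\{1,\dots,n-1\}$ are void. * Axiom 1: every vertex is on at most one $i$-edge for each $i$ (axiom 0), and for $2\le i\le n-1$ a vertex $w$ admits an $i$-neighbor if and only if $\sigma(w)_{i-1}=-\sigma(w)_i$. * Axiom 2: for each $i$-edge $\{w,x\}$, $\sigma(w)_j=-\sigma(x)_j$ for $j=i-1,i$, and $\sigma(w)_h=\sigma(x)_h$ for $h<i-2$ and for $h>i+1$. * Axiom 3: for each $i$-edge $\{w,x\}$, if $\sigma(w)_{i-2}=-\sigma(x)_{i-2}$ then $\sigma(w)_{i-2}=-\sigma(w)_{i-1}$, and if $\sigma(w)_{i+1}=-\sigma(x)_{i+1}$ then $\sigma(w)_{i+1}=-\sigma(w)_i$. * Axiom 4'a: for $4\le i\le n-1$, if $\{w,v\}$ is an $(i-1)$-edge and not an $i$-edge, $\sigma(w)_{i-3}\ne\sigma(v)_{i-3}$ and $\sigma(w)_i\ne\sigma(v)_i$, then $\mathrm{Res}_{[i-3,i]}(\mathcal G,w)$ and $\mathrm{Res}_{[i-2,i+1]}(\mathcal G,w)$ have the same generating function. * Axiom 4'b (for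 graphs that satisfy axiom 0): say that $v$ has $i$-type W if $v$ admits an $i$-neighbor and an $(i-1)$-neighbor and $\sigma(v)_i=-\sigma(E_{i-1}(v))_i$. For $4\le i<n$, a flat $i$-chain is a sequence $(x^1,\dots,x^{2h})$ of distinct vertices admitting $(i-2)$-neighbors such that $x^{2j-1}=E_i(x^{2j})$ for $1\le j\le h$ and, for $1\le j<h$, $x^{2j+1}=E_{i-2}(E_{i-1}E_{i-2})^{m_j}(x^{2j})$ for some integer $m_j\ge0$ such that $(E_{i-1}E_{i-2})^{m_j}(x^{2j})$ does not have $(i-1)$-type W (all the $E$'s being defined where they are applied). The axiom says: if $(x^1,\dots,x^{2h})$ is a flat $i$-chain and $x^j$ has $(i+1)$-type W for some $2<j<2h-1$, then $x^1,\dots,x^j$ all have $(i+1)$-type W or $x^j,\dots,x^{2h}$ all have $(i+1)$-type W. * Axiom 5: if $\{w,x\}$ is an $i$-edge and $\{x,y\}$ is a $j$-edge with $|i-j|\ge3$, then there is a vertex $v$ such that $\{w,v\}$ is a $j$-edge and $\{v,y\}$ is an $i$-edge. A D graph is a signed, colored graph that satisfies axioms 1, 2, 3, 4'a, 4'b, 5,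 $\mathrm{LSP}_4$ and $\mathrm{LSP}_5$. **Theorem.** Every D$_0$ graph satisfies axioms 1, 2, 3, 4'a, $\mathrm{LSP}_4$ and $\mathrm{LSP}_5$. Hence a D$_0$ graph is a D graph if and only if it satisfies axioms 4'b and 5. -/

import Mathlib

/-! ## Quasisymmetric functions, Schur functions, Schur positivity

Formal power series with integer coefficients in the variables `x_0, x_1, x_2, …`. -/

/-- Gessel's fundamental quasisymmetric function of degree `n`: the sum of the monomials
`x_{f 0} ⋯ x_{f (n-1)}` over all weakly increasing sequences `f` of length `n` that increase
strictly at each descent. The element `s` of `D` stands for the descent between the positions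
`s` and `s + 1` counted from `0`, i.e. for the descent `s + 1 ∈ {1, …, n - 1}`. -/
noncomputable def fundamentalQSym (n : ℕ) (D : Set (Fin (n - 1))) : MvPowerSeries ℕ ℤ :=
  fun m => (Nat.card {f : Fin n → ℕ //
    Monotone f ∧
    (∀ s : Fin (n - 1), s ∈ D → f ⟨s, by omega⟩ < f ⟨s + 1, by omega⟩) ∧
    ∑ k, Finsupp.single (f k) 1 = m} : ℤ)

/-- The Schur function `s_μ`: the sum over all semistandard Young tableaux of shape `μ`
of the monomial that records the entries. -/
noncomputable def schurFunction (μ : YoungDiagram) : MvPowerSeries ℕ ℤ :=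
  fun m => (Nat.card {T : SemistandardYoungTableau μ //
    ∑ c ∈ μ.cells, Finsupp.single (T c.1 c.2) 1 = m} : ℤ)

/-- A power series is Schur positive if it is a finite linear combination of Schur functions
with nonnegative integer coefficients. -/
def SchurPositive (F : MvPowerSeries ℕ ℤ) : Prop :=
  ∃ c : YoungDiagram →₀ ℕ, F = c.sum fun μ k => k • schurFunction μ

/-! ## Signed, colored graphs -/

/-- A signed, colored graph of degree `n` on the vertex set `V`: a graph whose edges are colored
from `{2, …, n - 1}` (one simple graph per color), with a signature `V → {+1, -1}^{n-1}`. -/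
structure SignedColoredGraph (n : ℕ) (V : Type*) where
  /-- `(edge i).Adj v w` says that `{v, w}` is an `i`-edge. -/
  edge : ℕ → SimpleGraph V
  color_mem : ∀ i v w, (edge i).Adj v w → 2 ≤ i ∧ i < n
  /-- The signature; the entry with index `s : Fin (n - 1)` is the coordinate `s + 1`. -/
  signature : V → Fin (n - 1) → ℤˣ

namespace SignedColoredGraph

variable {n : ℕ} {V : Type*}

/-- `G.sgn v i` is the `i`-th coordinate of the signature of `v`, for `1 ≤ i ≤ n - 1`.
(The value for other `i` is a placeholder which is never used below.) -/
def sgn (G : SignedColoredGraph n V) (v : V) (i : ℕ) : ℤˣ :=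
  if h : 1 ≤ i ∧ i < n then G.signature v ⟨i - 1, by omega⟩ else 1

/-- `v` admits an `i`-neighbor. -/
def AdmitsNeighbor (G : SignedColoredGraph n V) (i : ℕ) (v : V) : Prop :=
  ∃ w, (G.edge i).Adj v w

/-- The underlying graph, colors forgotten. -/
def graph (G : SignedColoredGraph n V) : SimpleGraph V := ⨆ i, G.edge i

/-- The restriction `Res_K G` to the interval `K = {a, a + 1, …, a + d - 1}`, a signed, colored
graph of degree `d` on the same vertices: its `s`-edges are the `(s + a - 1)`-edges of `G`, for
`2 ≤ s ≤ d - 1`, and the coordinates of its signature are the coordinates `a, …, a + d - 2` of the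
signature of `G`. (It is used only if `K` is contained in `{1, …, n}`.) -/
def res (G : SignedColoredGraph n V) (a d : ℕ) : SignedColoredGraph d V where
  edge s := if 2 ≤ s ∧ s < d then G.edge (s + a - 1) else ⊥
  color_mem s v w h := by
    by_contra hs
    rw [if_neg hs] at h
    exact h
  signature v s := G.sgn v (s + a)

/-- The descent set encoded by the signature of `v`. -/
def descents (G : SignedColoredGraph n V) (v : V) : Set (Fin (n - 1)) :=
  {s | G.signature v s = -1}

open Classical in
/-- The generating function of the connected component `C` of `G`. -/
noncomputable def componentGenFun [Fintype V] (G : SignedColoredGraph n V)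
    (C : G.graph.ConnectedComponent) : MvPowerSeries ℕ ℤ :=
  ∑ v : V with G.graph.connectedComponentMk v = C, fundamentalQSym n (G.descents v)

/-- Local Schur positivity for degree `d`: the generating function of each component of each
restriction to an interval of size `d` contained in `{1, …, n}` is Schur positive. -/
def LSP [Fintype V] (d : ℕ) (G : SignedColoredGraph n V) : Prop :=
  ∀ a, 1 ≤ a → a + d ≤ n + 1 →
    ∀ C : (G.res a d).graph.ConnectedComponent, SchurPositive ((G.res a d).componentGenFun C)

/-- Axiom 0: each vertex has at most one `i`-neighbor. -/
def Axiom0 (G : SignedColoredGraph n V) : Prop :=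
  ∀ i v w w', (G.edge i).Adj v w → (G.edge i).Adj v w' → w = w'

def Axiom1 (G : SignedColoredGraph n V) : Prop :=
  G.Axiom0 ∧ ∀ i w, 2 ≤ i → i < n → (G.AdmitsNeighbor i w ↔ G.sgn w (i - 1) = -G.sgn w i)

def Axiom2 (G : SignedColoredGraph n V) : Prop :=
  ∀ i w x, (G.edge i).Adj w x →
    G.sgn w (i - 1) = -G.sgn x (i - 1) ∧ G.sgn w i = -G.sgn x i ∧
    ∀ h, 1 ≤ h → h < n → (h + 2 < i ∨ i + 1 < h) → G.sgn w h = G.sgn x h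

/-- Axiom 3. The first condition is void if the coordinate `i - 2` does not exist (`i = 2`),
the second one if the coordinate `i + 1` does not exist (`i = n - 1`). -/
def Axiom3 (G : SignedColoredGraph n V) : Prop :=
  ∀ i w x, (G.edge i).Adj w x →
    (3 ≤ i → G.sgn w (i - 2) = -G.sgn x (i - 2) → G.sgn w (i - 2) = -G.sgn w (i - 1)) ∧
    (i + 1 < n → G.sgn w (i + 1) = -G.sgn x (i + 1) → G.sgn w (i + 1) = -G.sgn w i)

/-- Axiom 4'a. The two intervals `[i - 3, i]` and `[i - 2, i + 1]` have size 4, and both lie in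
`{1, …, n}` exactly if `4 ≤ i < n`. -/
def Axiom4a [Fintype V] (G : SignedColoredGraph n V) : Prop :=
  ∀ i w v, 4 ≤ i → i < n → (G.edge (i - 1)).Adj w v → ¬ (G.edge i).Adj w v →
    G.sgn w (i - 3) ≠ G.sgn v (i - 3) → G.sgn w i ≠ G.sgn v i →
    (G.res (i - 3) 4).componentGenFun ((G.res (i - 3) 4).graph.connectedComponentMk w) =
    (G.res (i - 2) 4).componentGenFun ((G.res (i - 2) 4).graph.connectedComponentMk w)

/-- `v` has `i`-type W (in a graph that satisfies axiom 0). -/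
def HasTypeW (G : SignedColoredGraph n V) (i : ℕ) (v : V) : Prop :=
  G.AdmitsNeighbor i v ∧ ∃ u, (G.edge (i - 1)).Adj v u ∧ G.sgn v i = -G.sgn u i

/-- `x 1, …, x (2 * h)` is a flat `i`-chain (in a graph that satisfies axiom 0, so that the edges
of one color are a partial involution `E`). The relation under `ReflTransGen` is
`z' = E_{i-1} (E_{i-2} z)`. -/
def IsFlatChain (G : SignedColoredGraph n V) (i h : ℕ) (x : ℕ → V) : Prop :=
  4 ≤ i ∧ i < n ∧
  Set.InjOn x (Set.Icc 1 (2 * h)) ∧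
  (∀ k, 1 ≤ k → k ≤ 2 * h → G.AdmitsNeighbor (i - 2) (x k)) ∧
  (∀ j, 1 ≤ j → j ≤ h → (G.edge i).Adj (x (2 * j - 1)) (x (2 * j))) ∧
  (∀ j, 1 ≤ j → j < h → ∃ z,
    Relation.ReflTransGen
      (fun z z' => ∃ u, (G.edge (i - 2)).Adj z u ∧ (G.edge (i - 1)).Adj u z') (x (2 * j)) z ∧
    ¬ G.HasTypeW (i - 1) z ∧
    (G.edge (i - 2)).Adj z (x (2 * j + 1)))

/-- Axiom 4'b. -/
def Axiom4b (G : SignedColoredGraph n V) : Prop :=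
  ∀ i h x, G.IsFlatChain i h x → ∀ j, 2 < j → j < 2 * h - 1 → G.HasTypeW (i + 1) (x j) →
    (∀ k, 1 ≤ k → k ≤ j → G.HasTypeW (i + 1) (x k)) ∨
    (∀ k, j ≤ k → k ≤ 2 * h → G.HasTypeW (i + 1) (x k))

def Axiom5 (G : SignedColoredGraph n V) : Prop :=
  ∀ i j w x y, (i + 3 ≤ j ∨ j + 3 ≤ i) → (G.edge i).Adj w x → (G.edge j).Adj x y →
    ∃ v, (G.edge j).Adj w v ∧ (G.edge i).Adj v y

/-- D graphs in the sense of Assaf. -/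
def IsDGraph [Fintype V] (G : SignedColoredGraph n V) : Prop :=
  G.Axiom1 ∧ G.Axiom2 ∧ G.Axiom3 ∧ G.Axiom4a ∧ G.Axiom4b ∧ G.Axiom5 ∧ G.LSP 4 ∧ G.LSP 5

end SignedColoredGraph

/-! ## D₀ graphs

Words in the alphabet of `N` letters are lists over `Fin N`. -/

/-- `{x, y}` is one of the two pairs `{v bac w, v bca w}`, `{v acb w, v cab w}` with letters
`a < b < c` and `|v| = i - 2`. -/
def IsKnuthPair {N : ℕ} (i : ℕ) (x y : List (Fin N)) : Prop :=
  ∃ (v w : List (Fin N)) (a b c : Fin N), a < b ∧ b < c ∧ v.length + 2 = i ∧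
    (({x, y} : Set (List (Fin N))) = {v ++ [b, a, c] ++ w, v ++ [b, c, a] ++ w} ∨
     ({x, y} : Set (List (Fin N))) = {v ++ [a, c, b] ++ w, v ++ [c, a, b] ++ w})

/-- `{x, y}` is one of the two pairs `{v bac w, v acb w}`, `{v bca w, v cab w}` with letters
`a < b < c` and `|v| = i - 2`. -/
def IsRotationPair {N : ℕ} (i : ℕ) (x y : List (Fin N)) : Prop :=
  ∃ (v w : List (Fin N)) (a b c : Fin N), a < b ∧ b < c ∧ v.length + 2 = i ∧
    (({x, y} : Set (List (Fin N))) = {v ++ [b, a, c] ++ w, v ++ [a, c, b] ++ w} ∨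
     ({x, y} : Set (List (Fin N))) = {v ++ [b, c, a] ++ w, v ++ [c, a, b] ++ w})

/-- A D₀ graph of degree `n` (alphabet of `N` letters): a graph on a set `verts` of words of
length `n` without repeated letter, with edges colored from `{2, …, n - 1}`, such that each
`i`-edge is a Knuth pair or a rotation pair at the positions `i - 1, i, i + 1`, and each vertex
in a square `{v bac w, v bca w, v acb w, v cab w}` with `|v| = i - 2` is on exactly one
`i`-edge. -/
structure D0Graph (N n : ℕ) where
  verts : Finset (List (Fin N))
  length_eq : ∀ x ∈ verts, x.length = n
  nodup : ∀ x ∈ verts, x.Nodup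
  edge : ℕ → SimpleGraph verts
  color_mem : ∀ i x y, (edge i).Adj x y → 2 ≤ i ∧ i < n
  isPair : ∀ i (x y : verts), (edge i).Adj x y →
    IsKnuthPair i (x : List (Fin N)) y ∨ IsRotationPair i (x : List (Fin N)) y
  existsUnique_edge : ∀ (i : ℕ) (v w : List (Fin N)) (a b c : Fin N),
    a < b → b < c → v.length + 2 = i →
    ∀ x : verts, (x : List (Fin N)) ∈ ({v ++ [b, a, c] ++ w, v ++ [b, c, a] ++ w,
      v ++ [a, c, b] ++ w, v ++ [c, a, b] ++ w} : Set (List (Fin N))) →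
    ∃! y, (edge i).Adj x y

/-- A D₀ graph as a signed, colored graph: the `i`-th sign of a word is `-1` if the word has a
descent at `i`, and `+1` otherwise. -/
def D0Graph.toSignedColoredGraph {N n : ℕ} (G : D0Graph N n) :
    SignedColoredGraph n G.verts where
  edge := G.edge
  color_mem := G.color_mem
  signature x s :=
    if x.1[(s : ℕ)]'(by rw [G.length_eq x.1 x.2]; omega) ≤
        x.1[(s : ℕ) + 1]'(by rw [G.length_eq x.1 x.2]; omega)
    then 1 else -1

/-!
Impose the square relations `mst + tsm = mts + stm` on words, for all letters `m` between `s` and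
`t`. Modulo them, the sum of `Q_{Des p} ⊗ p` over the permutations `p` of `d` letters equals
`∑ s_λ ⊗ J_λ` with noncommutative Schur functions `J_λ`; for `d = 4` and `d = 5` every `J_λ` is
represented by a sum of words. Hence `∑ g(p) Q_{Des p}` is Schur positive for every nonnegative
function `g` that respects the square relations. For a component of a restriction of a D₀ graph let
`g(p)` be the number of its vertices with a fixed outside and with pattern `p` in the window; the
`i`-edges match one side of each square with the other side, so `g` respects the square relations.

Axioms 1, 2 and 3 only involve the letters at an edge and their two neighbors. In axiom 4'a the sign
changes at both ends force the five letters around the edge to have, up to reversal of the order of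
the letters, the patterns `12043` and `10423`. Then both components are paths with five vertices and
alternating colors; their signatures are determined by a single sign, which is the same for both.
-/

/-! ## Schur functions as sums of fundamental quasisymmetric functions -/

/-- `e` lists the cells of `μ` along a linear extension of the componentwise order, i.e. it encodes
the standard Young tableau of shape `μ` whose entry `k` is in the cell `e k`. -/
structure IsLinearExtension (μ : YoungDiagram) {n : ℕ} (e : Fin n → ℕ × ℕ) : Prop where
  injective : Function.Injective e
  mem_iff : ∀ c, c ∈ μ ↔ c ∈ Set.range e
  le_of_le : ∀ i j, e i ≤ e j → i ≤ j

/-- The positions `s` such that the cell `e (s + 1)` is not in a column to the right of the column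
of `e s`: the descents of the standard Young tableau `e`. -/
def columnDescents {n : ℕ} (e : Fin n → ℕ × ℕ) : Set (Fin (n - 1)) :=
  {s | (e ⟨s + 1, by omega⟩).2 ≤ (e ⟨s, by omega⟩).2}

/-- The key by which standardization orders the cells of a filling: equal entries are ordered from
left to right. -/
def columnKey (T : ℕ → ℕ → ℕ) (c : ℕ × ℕ) : ℕ ×ₗ ℕ :=
  toLex (T c.1 c.2, c.2)

theorem strictMono_column_iff {n : ℕ} {e : Fin n → ℕ × ℕ} {f : Fin n → ℕ} :
    (StrictMono fun k => toLex (f k, (e k).2)) ↔ Monotone f ∧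
      ∀ s : Fin (n - 1), s ∈ columnDescents e → f ⟨s, by omega⟩ < f ⟨s + 1, by omega⟩ := by
  rcases n with _ | n
  · exact ⟨fun _ => ⟨fun a => a.elim0, fun s => s.elim0⟩, fun _ a => a.elim0⟩
  · rw [Fin.strictMono_iff_lt_succ, Fin.monotone_iff_le_succ]
    refine (forall_congr' fun i => ?_).trans forall_and
    change toLex (f i.castSucc, (e i.castSucc).2) < toLex (f i.succ, (e i.succ).2) ↔
      f i.castSucc ≤ f i.succ ∧
        ((e i.succ).2 ≤ (e i.castSucc).2 → f i.castSucc < f i.succ)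
    rw [Prod.Lex.toLex_lt_toLex]
    dsimp only
    omega

theorem injOn_columnKey {μ : YoungDiagram} (T : SemistandardYoungTableau μ) :
    Set.InjOn (columnKey T) {c | c ∈ μ} := by
  rintro ⟨i, j⟩ hc ⟨i', j'⟩ hd h
  obtain ⟨hT, rfl⟩ : T i j = T i' j' ∧ j = j' := by
    simpa only [columnKey, toLex_inj, Prod.mk.injEq] using h
  rcases lt_trichotomy i i' with hlt | rfl | hlt
  · exact absurd hT (T.col_strict hlt hd).ne
  · rfl
  · exact absurd hT (T.col_strict hlt hc).ne'

theorem columnKey_le_of_le {μ : YoungDiagram} (T : SemistandardYoungTableau μ) {c d : ℕ × ℕ}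
    (h : c ≤ d) (hd : d ∈ μ) : columnKey T c ≤ columnKey T d := by
  have hT : T c.1 c.2 ≤ T d.1 d.2 :=
    (T.row_weak_of_le h.2 (μ.up_left_mem h.1 le_rfl hd)).trans (T.col_weak h.1 hd)
  exact Prod.Lex.toLex_le_toLex.2 (hT.lt_or_eq.imp_right fun hT => ⟨hT, h.2⟩)

theorem exists_linearExtension {μ : YoungDiagram} (T : SemistandardYoungTableau μ) {n : ℕ}
    (hn : μ.cells.card = n) :
    ∃ e : Fin n → ℕ × ℕ, IsLinearExtension μ e ∧ StrictMono (columnKey T ∘ e) := by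
  have hinj : Set.InjOn (columnKey T) (μ.cells : Set (ℕ × ℕ)) := injOn_columnKey T
  have hcard : (μ.cells.image (columnKey T)).card = n := by
    rw [Finset.card_image_of_injOn hinj, hn]
  let o := (μ.cells.image (columnKey T)).orderEmbOfFin hcard
  have ho : ∀ k, ∃ c ∈ μ.cells, columnKey T c = o k := fun k =>
    Finset.mem_image.1 (Finset.orderEmbOfFin_mem _ hcard k)
  choose e hmem hkey using ho
  have hmono : StrictMono (columnKey T ∘ e) := fun a b hab => by
    simpa only [Function.comp_apply, hkey] using o.strictMono hab
  refine ⟨e, ⟨hmono.injective.of_comp, fun c => ⟨fun hc => ?_, ?_⟩, fun i j hij => ?_⟩, hmono⟩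
  · have : columnKey T c ∈ Set.range o := by
      rw [Finset.range_orderEmbOfFin]
      exact Finset.mem_coe.2 (Finset.mem_image_of_mem _ hc)
    obtain ⟨k, hk⟩ := this
    exact ⟨k, hinj (hmem k) hc ((hkey k).trans hk)⟩
  · rintro ⟨k, rfl⟩
    exact hmem k
  · exact hmono.le_iff_le.1 (columnKey_le_of_le T hij (hmem j))

namespace IsLinearExtension

variable {μ : YoungDiagram} {n : ℕ} {e e' : Fin n → ℕ × ℕ} {f : Fin n → ℕ}

theorem mem (he : IsLinearExtension μ e) (k : Fin n) : e k ∈ μ :=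
  (he.mem_iff _).2 ⟨k, rfl⟩

theorem eq_of_strictMono {T : SemistandardYoungTableau μ} (he : IsLinearExtension μ e)
    (he' : IsLinearExtension μ e') (h : StrictMono (columnKey T ∘ e))
    (h' : StrictMono (columnKey T ∘ e')) : e = e' := by
  have hrange : Set.range (columnKey T ∘ e) = Set.range (columnKey T ∘ e') := by
    rw [Set.range_comp, Set.range_comp, ← Set.ext he.mem_iff, ← Set.ext he'.mem_iff]
  have heq := (StrictMono.range_inj h h').1 hrange
  exact funext fun k => injOn_columnKey T (he.mem k) (he'.mem k) (congrFun heq k)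

theorem sum_cells {M : Type*} [AddCommMonoid M] (he : IsLinearExtension μ e) (F : ℕ × ℕ → M) :
    ∑ c ∈ μ.cells, F c = ∑ k, F (e k) := by
  have hcells : μ.cells = Finset.univ.image e := by
    ext c
    simpa using he.mem_iff c
  rw [hcells, Finset.sum_image fun a _ b _ h => he.injective h]

theorem exists_tableau (he : IsLinearExtension μ e)
    (hf : StrictMono fun k => toLex (f k, (e k).2)) :
    ∃ T : SemistandardYoungTableau μ, ∀ k, T (e k).1 (e k).2 = f k := by
  have hext : ∀ k, Function.extend e f 0 (e k) = f k := he.injective.extend_apply f 0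
  have key_lt : ∀ {c d : ℕ × ℕ}, c < d → d ∈ μ →
      toLex (Function.extend e f 0 c, c.2) < toLex (Function.extend e f 0 d, d.2) := by
    intro c d hcd hd
    obtain ⟨l, rfl⟩ := (he.mem_iff d).1 hd
    obtain ⟨k, rfl⟩ := (he.mem_iff c).1 (μ.up_left_mem hcd.le.1 hcd.le.2 hd)
    rw [hext, hext]
    exact hf (lt_of_le_of_ne (he.le_of_le k l hcd.le) fun h => hcd.ne (congrArg e h))
  refine ⟨⟨fun i j => Function.extend e f 0 (i, j), fun {i j j'} h hc => ?_,
    fun {i i' j} h hc => ?_, fun {i j} hc => ?_⟩, hext⟩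
  · rcases Prod.Lex.toLex_lt_toLex.1 (key_lt (Prod.mk_lt_mk_iff_right.2 h) hc) with hlt | ⟨heq, -⟩
    exacts [le_of_lt hlt, le_of_eq heq]
  · rcases Prod.Lex.toLex_lt_toLex.1 (key_lt (Prod.mk_lt_mk_iff_left.2 h) hc) with hlt | ⟨-, hlt⟩
    exacts [hlt, absurd hlt (lt_irrefl j)]
  · exact Function.extend_apply' _ _ _ fun h => hc ((he.mem_iff _).2 h)

theorem tableau_ext (he : IsLinearExtension μ e) {T T' : SemistandardYoungTableau μ}
    (h : ∀ k, T (e k).1 (e k).2 = T' (e k).1 (e k).2) : T = T' := by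
  refine SemistandardYoungTableau.ext fun i j => ?_
  by_cases hc : (i, j) ∈ μ
  · obtain ⟨k, hk⟩ := (he.mem_iff _).1 hc
    simpa only [hk] using h k
  · rw [T.zeros hc, T'.zeros hc]

end IsLinearExtension

theorem finite_of_content_eq {n : ℕ} (P : (Fin n → ℕ) → Prop) (m : ℕ →₀ ℕ)
    (hP : ∀ f, P f → ∑ k, Finsupp.single (f k) 1 = m) : Finite {f // P f} := by
  have hfin : Set.Finite {f : Fin n → ℕ | ∀ k, f k ∈ (m.support : Set ℕ)} :=
    Set.Finite.pi' fun _ => m.support.finite_toSet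
  refine (hfin.subset fun f hf k => ?_ : Set.Finite {f | P f}).to_subtype
  rw [Finset.mem_coe, Finsupp.mem_support_iff, ← hP f hf, Finsupp.finsetSum_apply]
  exact (Finset.sum_pos' (fun _ _ => Nat.zero_le _) ⟨k, Finset.mem_univ k, by simp⟩).ne'

/-- Standardization: a semistandard tableau is a standard tableau `e` together with the weakly
increasing sequence of its entries. -/
theorem exists_bijective_standardization {μ : YoungDiagram} {n : ℕ} (hn : μ.cells.card = n)
    (S : Finset (Fin n → ℕ × ℕ)) (hS : ∀ e, e ∈ S ↔ IsLinearExtension μ e) (m : ℕ →₀ ℕ) :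
    ∃ Φ : (Σ e : S, {f : Fin n → ℕ // (StrictMono fun k => toLex (f k, (e.1 k).2)) ∧
        ∑ k, Finsupp.single (f k) 1 = m}) →
      {T : SemistandardYoungTableau μ // ∑ c ∈ μ.cells, Finsupp.single (T c.1 c.2) 1 = m},
      Function.Bijective Φ := by
  have hext := fun e : S => (hS e.1).1 e.2
  choose T hT using fun (e : S) (f : Fin n → ℕ) hf => (hext e).exists_tableau (f := f) hf
  have hcont : ∀ e f hf, ∑ c ∈ μ.cells, Finsupp.single (T e f hf c.1 c.2) 1 =
      ∑ k, Finsupp.single (f k) 1 := fun e f hf => by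
    rw [(hext e).sum_cells fun c => Finsupp.single (T e f hf c.1 c.2) 1]
    simp only [hT]
  have hstrict : ∀ e f hf, StrictMono (columnKey (T e f hf) ∘ e.1) := fun e f hf => by
    simpa only [columnKey, Function.comp_def, hT] using hf
  refine ⟨fun x => ⟨T x.1 x.2 x.2.2.1, (hcont _ _ _).trans x.2.2.2⟩, ?_, ?_⟩
  · rintro ⟨e, f, hf, hm⟩ ⟨e', f', hf', hm'⟩ h
    have hTT : T e f hf = T e' f' hf' := congrArg Subtype.val h
    obtain rfl : e = e' := Subtype.ext ((hext e).eq_of_strictMono (hext e') (hstrict e f hf)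
      (hTT ▸ hstrict e' f' hf'))
    obtain rfl : f = f' := funext fun k => by rw [← hT e f hf, ← hT e f' hf', hTT]
    rfl
  · rintro ⟨T', hm⟩
    obtain ⟨e, he, hmono⟩ := exists_linearExtension T' hn
    let E : S := ⟨e, (hS e).2 he⟩
    have heq : T E _ hmono = T' := he.tableau_ext fun k => hT E _ hmono k
    exact ⟨⟨E, _, hmono, by rw [← hcont E _ hmono, heq, hm]⟩, Subtype.ext heq⟩

theorem schurFunction_eq_sum (μ : YoungDiagram) {n : ℕ} (hn : μ.cells.card = n)
    (S : Finset (Fin n → ℕ × ℕ)) (hS : ∀ e, e ∈ S ↔ IsLinearExtension μ e) :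
    schurFunction μ = ∑ e ∈ S, fundamentalQSym n (columnDescents e) := by
  refine MvPowerSeries.ext fun m => ?_
  rw [map_sum, ← Finset.sum_coe_sort]
  simp only [MvPowerSeries.coeff_apply, schurFunction, fundamentalQSym, ← and_assoc,
    ← strictMono_column_iff]
  have hfin := fun e : S => finite_of_content_eq (fun f =>
    (StrictMono fun k => toLex (f k, (e.1 k).2)) ∧ ∑ k, Finsupp.single (f k) 1 = m) m
    fun _ h => h.2
  obtain ⟨Φ, hΦ⟩ := exists_bijective_standardization hn S hS m
  rw [← Nat.cast_sum, ← Nat.card_sigma, Nat.card_congr (Equiv.ofBijective Φ hΦ)]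

/-- The bits of `descentBits r L` tell for which consecutive entries `a, b` of `L` the relation
`r a b` holds; they encode the descents of words and of standard tableaux alike. -/
def descentBits {α : Type*} (r : α → α → Prop) [DecidableRel r] (L : List α) : List Bool :=
  List.zipWith (fun a b => decide (r a b)) L L.tail

/-- The fundamental quasisymmetric function whose descents are the `true` entries of `D`. -/
noncomputable def qsymOfBits (n : ℕ) (D : List Bool) : MvPowerSeries ℕ ℤ :=
  fundamentalQSym n {s | D[(s : ℕ)]? = some true}

theorem qsymOfBits_descentBits {α : Type*} (r : α → α → Prop) [DecidableRel r] {n : ℕ}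
    {L : List α} (hL : L.length = n) :
    qsymOfBits n (descentBits r L) =
      fundamentalQSym n {s | r (L[(s : ℕ)]'(by omega)) (L[(s : ℕ) + 1]'(by omega))} := by
  subst hL
  refine congrArg (fundamentalQSym _) (Set.ext fun s => ?_)
  simp [descentBits]

/-- The orderings of a list of cells in which no cell comes after a cell that is larger in both
coordinates. -/
def linearExtensions (l : List (ℕ × ℕ)) : List (List (ℕ × ℕ)) :=
  l.permutations'.filter fun L => L.Pairwise fun c d => ¬ d ≤ c

theorem nodup_linearExtensions {l : List (ℕ × ℕ)} (hl : l.Nodup) : (linearExtensions l).Nodup :=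
  ((List.permutations_perm_permutations' l).nodup_iff.1 (List.nodup_permutations l hl)).filter _

theorem mem_linearExtensions {l L : List (ℕ × ℕ)} :
    L ∈ linearExtensions l ↔ L.Perm l ∧ L.Pairwise fun c d => ¬ d ≤ c := by
  rw [linearExtensions, List.mem_filter, decide_eq_true_iff, List.mem_permutations']

theorem ofFn_mem_linearExtensions_iff {μ : YoungDiagram} {l : List (ℕ × ℕ)} (hl : l.Nodup)
    (hμ : ∀ c, c ∈ l ↔ c ∈ μ) {n : ℕ} (e : Fin n → ℕ × ℕ) :
    List.ofFn e ∈ linearExtensions l ↔ IsLinearExtension μ e := by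
  simp only [mem_linearExtensions, List.pairwise_ofFn]
  constructor
  · rintro ⟨hperm, hlt⟩
    refine ⟨List.nodup_ofFn.1 (hperm.nodup_iff.2 hl), fun c => ?_, fun i j hij => ?_⟩
    · rw [← hμ, ← hperm.mem_iff, List.mem_ofFn']
    · exact not_lt.1 fun h => hlt h hij
  · rintro ⟨hinj, hmem, hle⟩
    refine ⟨(List.perm_ext_iff_of_nodup (List.nodup_ofFn.2 hinj) hl).2 fun c => ?_, ?_⟩
    · rw [List.mem_ofFn', hμ, hmem]
    · exact fun i j hij h => (hle j i h).not_gt hij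

theorem schurFunction_eq_sum_linearExtensions (μ : YoungDiagram) {l : List (ℕ × ℕ)}
    (hl : l.Nodup) (hμ : ∀ c, c ∈ l ↔ c ∈ μ) :
    schurFunction μ = ((linearExtensions l).map fun L =>
      qsymOfBits l.length (descentBits (fun c d => d.2 ≤ c.2) L)).sum := by
  have hn : μ.cells.card = l.length := by
    rw [← List.toFinset_card_of_nodup hl]
    exact congrArg _ (Finset.ext fun c => by rw [List.mem_toFinset, hμ, YoungDiagram.mem_cells])
  rw [← List.sum_toFinset _ (nodup_linearExtensions hl), schurFunction_eq_sum μ hn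
    ((linearExtensions l).toFinset.preimage List.ofFn List.ofFn_injective.injOn)
    fun e => by rw [Finset.mem_preimage, List.mem_toFinset, ofFn_mem_linearExtensions_iff hl hμ],
    ← Finset.sum_preimage List.ofFn _ List.ofFn_injective.injOn]
  · refine Finset.sum_congr rfl fun e _ => ?_
    rw [qsymOfBits_descentBits _ List.length_ofFn]
    simp [columnDescents]
  · intro L hL hrange
    rw [List.mem_toFinset, mem_linearExtensions] at hL
    refine absurd ⟨fun k => L[k]'(k.isLt.trans_eq hL.1.length_eq.symm), ?_⟩ hrange
    exact List.ext_getElem (by rw [List.length_ofFn, hL.1.length_eq]) fun _ _ _ => by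
      rw [List.getElem_ofFn, Fin.getElem_fin]

/-- The cells of the Young diagram with row lengths `w`. -/
def rowCells (w : List ℕ) : List (ℕ × ℕ) :=
  (List.range w.length).flatMap fun i => (List.range (w.getD i 0)).map fun j => (i, j)

theorem nodup_rowCells (w : List ℕ) : (rowCells w).Nodup := by
  refine List.nodup_flatMap.2 ⟨fun i _ => List.nodup_range.map (Prod.mk_right_injective i),
    List.nodup_range.imp fun {i i'} hne => ?_⟩
  simp [Function.onFun, List.disjoint_left, Ne.symm hne]

theorem mem_rowCells {w : List ℕ} (hw : w.SortedGE) (c : ℕ × ℕ) :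
    c ∈ rowCells w ↔ c ∈ YoungDiagram.ofRowLens w hw := by
  obtain ⟨i, j⟩ := c
  by_cases hi : i < w.length <;>
    simp [rowCells, YoungDiagram.mem_ofRowLens, hi]

/-! ## Positivity of sums over words that respect the square relations -/

/-- `g` takes the same total on the two edges `{mst, tsm}` and `{mts, stm}` that make up a square of
words, where the letter `m` is between the letters `s` and `t`. -/
def IsBalanced {α M : Type*} [LinearOrder α] [Add M] (g : List α → M) : Prop :=
  ∀ (u w : List α) (m s t : α), m ∈ Set.uIoo s t →
    g (u ++ m :: s :: t :: w) + g (u ++ t :: s :: m :: w) =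
      g (u ++ m :: t :: s :: w) + g (u ++ s :: t :: m :: w)

theorem mem_uIoo_iff {α : Type*} [LinearOrder α] {m s t : α} :
    m ∈ Set.uIoo s t ↔ s < m ∧ m < t ∨ t < m ∧ m < s := by
  rcases le_total s t with h | h
  · rw [Set.uIoo_of_le h, Set.mem_Ioo, or_iff_left fun h' => ((h'.1.trans h'.2).not_ge h).elim]
  · rw [Set.uIoo_of_ge h, Set.mem_Ioo, or_iff_right fun h' => ((h'.1.trans h'.2).not_ge h).elim]

/-- Formal integer combinations of words, as lists of terms. -/
abbrev FormalSum (α : Type*) := List (ℤ × List α)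

namespace FormalSum

variable {α M : Type*} [AddCommGroup M]

/-- The value of a formal sum if the word `w` is evaluated to `g w`. -/
def eval (g : List α → M) (v : FormalSum α) : M :=
  (v.map fun x => x.1 • g x.2).sum

variable [DecidableEq α]

/-- Adds the term `c • w` to a formal sum, with like terms collected. -/
def addTerm (c : ℤ) (w : List α) : FormalSum α → FormalSum α
  | [] => [(c, w)]
  | x :: v => if w = x.2 then (if c + x.1 = 0 then v else (c + x.1, w) :: v)
      else x :: addTerm c w v

/-- The image of a formal sum under the linear extension of `f`. -/
def bind (f : List α → FormalSum α) (v : FormalSum α) : FormalSum α :=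
  v.foldr (fun x acc => (f x.2).foldr (fun y => addTerm (x.1 * y.1) y.2) acc) []

theorem eval_addTerm (g : List α → M) (c : ℤ) (w : List α) (v : FormalSum α) :
    eval g (addTerm c w v) = c • g w + eval g v := by
  induction v with
  | nil => simp [eval, addTerm]
  | cons x v ih =>
    simp only [eval] at ih
    simp only [addTerm, eval]
    split_ifs with hw h0
    · simp [hw, ← add_assoc, ← add_smul, h0]
    · simp [hw, ← add_assoc, ← add_smul]
    · simp [ih, add_left_comm]

theorem eval_bind {g : List α → M} {f : List α → FormalSum α} (hf : ∀ w, eval g (f w) = g w)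
    (v : FormalSum α) : eval g (bind f v) = eval g v := by
  have hterm : ∀ (c : ℤ) (v acc : FormalSum α),
      eval g (v.foldr (fun y => addTerm (c * y.1) y.2) acc) = c • eval g v + eval g acc := by
    intro c v acc
    induction v with
    | nil => simp [eval]
    | cons y v ih =>
      rw [List.foldr_cons, eval_addTerm, ih]
      simp only [eval, List.map_cons, List.sum_cons, smul_add, mul_smul, add_assoc]
  induction v with
  | nil => rfl
  | cons x v ih =>
    rw [bind, List.foldr_cons, hterm, hf, ← bind, ih]
    simp only [eval, List.map_cons, List.sum_cons]

end FormalSum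

/-- For letters `m` between `s` and `t` in the order `r`, rewrites the letters `mst` at position `k`
of a word as `mts + stm - tsm`. -/
def rewriteSquare {α : Type*} (r : α → α → Prop) [DecidableRel r] : ℕ → List α → FormalSum α
  | 0, m :: s :: t :: w => if r s m ∧ r m t then
      [(1, m :: t :: s :: w), (1, s :: t :: m :: w), (-1, t :: s :: m :: w)]
      else [(1, m :: s :: t :: w)]
  | k + 1, a :: w => (rewriteSquare r k w).map (Prod.map id (a :: ·))
  | _, w => [(1, w)]

/-- Applies the rewriting rule `rewriteSquare r` at the positions `d - 3, …, 0`. -/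
def sweep {α : Type*} [DecidableEq α] (r : α → α → Prop) [DecidableRel r] (d : ℕ)
    (v : FormalSum α) : FormalSum α :=
  (List.range (d - 2)).foldr (fun k => FormalSum.bind (rewriteSquare r k)) v

/-- A sequence of rewritings of words of length `d`, to test whether a formal sum is `0` modulo the
square relations; it was found by experiment for `d = 4` and `d = 5`. -/
def reduce {α : Type*} [LinearOrder α] (d : ℕ) (v : FormalSum α) : FormalSum α :=
  sweep (· < ·) d (sweep (· < ·) d (sweep (· > ·) d v))

section Soundness

variable {α M : Type*} [LinearOrder α] [AddCommGroup M] {g : List α → M}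

theorem IsBalanced.comp_cons (hg : IsBalanced g) (a : α) : IsBalanced fun w => g (a :: w) :=
  fun u w m s t h => hg (a :: u) w m s t h

theorem IsBalanced.eval_rewriteSquare (hg : IsBalanced g) {r : α → α → Prop} [DecidableRel r]
    (hr : ∀ s m t, r s m → r m t → m ∈ Set.uIoo s t) (k : ℕ) (w : List α) :
    FormalSum.eval g (rewriteSquare r k w) = g w := by
  fun_induction rewriteSquare r k w generalizing g with
  | case1 m s t w h =>
    have hbal : g (m :: s :: t :: w) + g (t :: s :: m :: w) =
        g (m :: t :: s :: w) + g (s :: t :: m :: w) := hg [] w m s t (hr s m t h.1 h.2)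
    simp [FormalSum.eval, ← add_assoc, ← hbal]
  | case3 k a w ih =>
    rw [← ih (hg.comp_cons a)]
    simp [FormalSum.eval, Function.comp_def]
  | case2 | case4 => simp [FormalSum.eval]

theorem IsBalanced.eval_sweep (hg : IsBalanced g) {r : α → α → Prop} [DecidableRel r]
    (hr : ∀ s m t, r s m → r m t → m ∈ Set.uIoo s t) (d : ℕ) (v : FormalSum α) :
    FormalSum.eval g (sweep r d v) = FormalSum.eval g v := by
  rw [sweep]
  induction List.range (d - 2) with
  | nil => rfl
  | cons k l ih => rw [List.foldr_cons, FormalSum.eval_bind (hg.eval_rewriteSquare hr k), ih]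

theorem IsBalanced.eval_reduce (hg : IsBalanced g) (d : ℕ) (v : FormalSum α) :
    FormalSum.eval g (reduce d v) = FormalSum.eval g v := by
  have hlt : ∀ s m t : α, s < m → m < t → m ∈ Set.uIoo s t := fun s m t hs ht =>
    mem_uIoo_iff.2 (Or.inl ⟨hs, ht⟩)
  have hgt : ∀ s m t : α, s > m → m > t → m ∈ Set.uIoo s t := fun s m t hs ht =>
    mem_uIoo_iff.2 (Or.inr ⟨ht, hs⟩)
  rw [reduce, hg.eval_sweep hlt, hg.eval_sweep hlt, hg.eval_sweep hgt]

end Soundness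

/-- The words of length `d` in which each of the letters `0, …, d - 1` occurs once. -/
def permWords (d : ℕ) : List (List (Fin d)) :=
  (List.finRange d).permutations'

theorem mem_permWords {d : ℕ} {p : List (Fin d)} : p ∈ permWords d ↔ p.Perm (List.finRange d) :=
  List.mem_permutations'

theorem nodup_permWords (d : ℕ) : (permWords d).Nodup :=
  (List.permutations_perm_permutations' _).nodup_iff.1
    (List.nodup_permutations _ (List.nodup_finRange d))

theorem length_of_mem_permWords {d : ℕ} {p : List (Fin d)} (hp : p ∈ permWords d) :
    p.length = d :=
  (mem_permWords.1 hp).length_eq.trans (List.length_finRange)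

/-- The descents of a word. -/
def wordDescents {α : Type*} [LinearOrder α] (p : List α) : List Bool :=
  descentBits (· > ·) p

/-- The descents of a standard tableau, given as a linear extension. -/
def tableauDescents (T : List (ℕ × ℕ)) : List Bool :=
  descentBits (fun c c' => c'.2 ≤ c.2) T

/-- A partition of `d`, given by its row lengths, together with words whose sum represents the
noncommutative Schur function of this partition modulo the square relations. -/
structure SchurWords (d : ℕ) where
  rows : List ℕ
  sorted : rows.SortedGE
  card_cells : (rowCells rows).length = d
  words : List (List (Fin d))

namespace SchurWords

variable {d : ℕ}

/-- The Schur function of the partition. -/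
noncomputable def schur (J : SchurWords d) : MvPowerSeries ℕ ℤ :=
  schurFunction (YoungDiagram.ofRowLens J.rows J.sorted)

theorem schur_eq_sum (J : SchurWords d) :
    J.schur = ((linearExtensions (rowCells J.rows)).map fun T =>
      qsymOfBits d (tableauDescents T)).sum := by
  rw [schur, schurFunction_eq_sum_linearExtensions _ (nodup_rowCells _) (mem_rowCells J.sorted),
    J.card_cells]
  rfl

/-- The formal sum over all words minus the formal sums of the words in `l`, the latter once for
each standard tableau of the corresponding shape. Each term is tagged with the descents of its word
or tableau. -/
def taggedTerms (l : List (SchurWords d)) : List ((ℤ × List (Fin d)) × List Bool) :=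
  (permWords d).map (fun p => ((1, p), wordDescents p)) ++
    l.flatMap fun J => (linearExtensions (rowCells J.rows)).flatMap fun T =>
      J.words.map fun w => ((-1, w), tableauDescents T)

theorem length_tag {l : List (SchurWords d)} {x : (ℤ × List (Fin d)) × List Bool}
    (hx : x ∈ taggedTerms l) : x.2.length = d - 1 := by
  have hbits : ∀ {α : Type} (r : α → α → Prop) [DecidableRel r] {L : List α},
      L.length = d → (descentBits r L).length = d - 1 := by
    intro α r _ L hL
    rw [descentBits, List.length_zipWith, List.length_tail, hL, min_eq_right (Nat.sub_le _ _)]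
  simp only [taggedTerms, List.mem_append, List.mem_map, List.mem_flatMap] at hx
  rcases hx with ⟨p, hp, rfl⟩ | ⟨J, -, T, hT, w, -, rfl⟩
  · exact hbits _ (length_of_mem_permWords hp)
  · exact hbits _ ((mem_linearExtensions.1 hT).1.length_eq.trans J.card_cells)

/-- The tagged terms of `l` with any given descents reduce to `0`. -/
def IsComplete (l : List (SchurWords d)) : Prop :=
  ∀ D : Fin (d - 1) → Bool,
    reduce d (((taggedTerms l).filter fun x => x.2 = List.ofFn D).map Prod.fst) = []

end SchurWords

theorem sum_map_smul_eq_sum_fibers {β κ ι R M : Type*} [Fintype κ] [DecidableEq ι] [Semiring R]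
    [AddCommMonoid M] [Module R M] {b : κ → ι} (hb : Function.Injective b) (c : β → R) (f : β → ι)
    (Q : ι → M) {L : List β} (hL : ∀ x ∈ L, f x ∈ Set.range b) :
    (L.map fun x => c x • Q (f x)).sum =
      ∑ k, ((L.filter fun x => f x = b k).map c).sum • Q (b k) := by
  classical
  induction L with
  | nil => simp
  | cons x L ih =>
    obtain ⟨k, hk⟩ := hL x (List.mem_cons_self ..)
    have hsplit : ∀ k', (((x :: L).filter fun x => f x = b k').map c).sum • Q (b k') =
        (if k = k' then c x • Q (b k) else 0) +
          ((L.filter fun x => f x = b k').map c).sum • Q (b k') := by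
      intro k'
      by_cases h : k = k'
      · subst h
        simp [← hk, add_smul]
      · simp [← hk, hb.ne h, h]
    simp only [hsplit, Finset.sum_add_distrib, Finset.sum_ite_eq, Finset.mem_univ, if_true]
    rw [List.map_cons, List.sum_cons, hk, ih fun y hy => hL y (List.mem_cons_of_mem x hy)]

section Positivity

variable {d : ℕ} {l : List (SchurWords d)}

theorem IsBalanced.sum_taggedTerms_eq_zero {g : List (Fin d) → ℤ} (hg : IsBalanced g)
    (hl : SchurWords.IsComplete l) :
    ((SchurWords.taggedTerms l).map fun x =>
      (x.1.1 * g x.1.2) • qsymOfBits d x.2).sum = 0 := by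
  have hfiber : ∀ D : Fin (d - 1) → Bool, (((SchurWords.taggedTerms l).filter
      fun x => x.2 = List.ofFn D).map fun x => x.1.1 * g x.1.2).sum = 0 := fun D => by
    have heval := hg.eval_reduce d (((SchurWords.taggedTerms l).filter
      fun x => x.2 = List.ofFn D).map Prod.fst)
    rw [hl D, FormalSum.eval, FormalSum.eval, List.map_map] at heval
    exact heval.symm
  rw [sum_map_smul_eq_sum_fibers List.ofFn_injective _ _ (qsymOfBits d)]
  · exact Finset.sum_eq_zero fun D _ => by rw [hfiber, zero_smul]
  · exact fun x hx => ⟨fun k => x.2[k]'(k.isLt.trans_eq (SchurWords.length_tag hx).symm),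
      List.ext_getElem (by rw [List.length_ofFn, SchurWords.length_tag hx]) fun _ _ _ => by
        rw [List.getElem_ofFn, Fin.getElem_fin]⟩

theorem IsBalanced.sum_permWords_eq {g : List (Fin d) → ℤ} (hg : IsBalanced g)
    (hl : SchurWords.IsComplete l) :
    ((permWords d).map fun p => g p • qsymOfBits d (wordDescents p)).sum =
      (l.map fun J => (J.words.map g).sum • J.schur).sum := by
  have hJ : ∀ J : SchurWords d, ((linearExtensions (rowCells J.rows)).flatMap fun T =>
      J.words.map fun w => (-1 * g w) • qsymOfBits d (tableauDescents T)).sum =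
        -((J.words.map g).sum • J.schur) := fun J => by
    rw [← neg_smul, ← neg_one_mul (J.words.map g).sum, ← List.sum_map_mul_left, J.schur_eq_sum,
      List.smul_sum, List.flatMap_def, List.sum_flatten]
    simp only [List.map_map, Function.comp_def, List.sum_smul]
  have hzero := hg.sum_taggedTerms_eq_zero hl
  simp only [SchurWords.taggedTerms, List.map_append, List.sum_append, List.map_map,
    List.map_flatMap, Function.comp_def, one_mul] at hzero
  rw [eq_neg_of_add_eq_zero_left hzero, neg_eq_iff_eq_neg, List.flatMap_def, List.sum_flatten,
    List.map_map]
  simp only [Function.comp_def, hJ]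
  rw [List.sum_neg, List.map_map, Function.comp_def]

theorem SchurPositive.zero : SchurPositive 0 :=
  ⟨0, Finsupp.sum_zero_index.symm⟩

theorem SchurPositive.add {F F' : MvPowerSeries ℕ ℤ} (h : SchurPositive F)
    (h' : SchurPositive F') : SchurPositive (F + F') := by
  obtain ⟨c, rfl⟩ := h
  obtain ⟨c', rfl⟩ := h'
  refine ⟨c + c', (Finsupp.sum_add_index' (fun _ => ?_) fun _ _ _ => ?_).symm⟩
  · exact zero_smul ℕ _
  · exact add_smul _ _ _

theorem SchurPositive.nsmul_schurFunction (k : ℕ) (μ : YoungDiagram) :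
    SchurPositive (k • schurFunction μ) :=
  ⟨Finsupp.single μ k, by simp⟩

theorem IsBalanced.schurPositive {g : List (Fin d) → ℕ} (hg : IsBalanced g)
    (hl : SchurWords.IsComplete l) :
    SchurPositive ((permWords d).map fun p => g p • qsymOfBits d (wordDescents p)).sum := by
  have hcast : IsBalanced fun w => (g w : ℤ) := fun u w m s t h => by
    simpa only [Nat.cast_add] using congrArg (Nat.cast : ℕ → ℤ) (hg u w m s t h)
  have hsum := hcast.sum_permWords_eq hl
  simp only [natCast_zsmul] at hsum
  rw [hsum]
  clear hl hsum
  induction l with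
  | nil => exact SchurPositive.zero
  | cons J l ih =>
    have hJ : (J.words.map fun w => (g w : ℤ)).sum = ((J.words.map g).sum : ℕ) := by
      rw [Nat.cast_list_sum, List.map_map]
      rfl
    rw [List.map_cons, List.sum_cons, hJ, natCast_zsmul]
    exact (SchurPositive.nsmul_schurFunction _ _).add ih

end Positivity

/-- The words of length `d` with descents `D`. For a hook shape, the words with the descents of one
of its standard tableaux can be used as the words in `SchurWords`. -/
def wordsWithDescents (d : ℕ) (D : List Bool) : List (List (Fin d)) :=
  (permWords d).filter fun p => wordDescents p = D

/-- Words for all the partitions of `4`. -/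
def schurWordsFour : List (SchurWords 4) :=
  [⟨[4], by decide, rfl, wordsWithDescents 4 [false, false, false]⟩,
   ⟨[3, 1], by decide, rfl, wordsWithDescents 4 [true, false, false]⟩,
   ⟨[2, 2], by decide, rfl, [[1, 0, 3, 2], [2, 3, 0, 1]]⟩,
   ⟨[2, 1, 1], by decide, rfl, wordsWithDescents 4 [true, true, false]⟩,
   ⟨[1, 1, 1, 1], by decide, rfl, wordsWithDescents 4 [true, true, true]⟩]

/-- Words for all the partitions of `5`. -/
def schurWordsFive : List (SchurWords 5) :=
  [⟨[5], by decide, rfl, wordsWithDescents 5 [false, false, false, false]⟩,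
   ⟨[4, 1], by decide, rfl, wordsWithDescents 5 [true, false, false, false]⟩,
   ⟨[3, 2], by decide, rfl,
    [[1, 0, 3, 2, 4], [1, 0, 4, 2, 3], [2, 3, 0, 1, 4], [2, 4, 0, 1, 3], [3, 4, 0, 1, 2]]⟩,
   ⟨[3, 1, 1], by decide, rfl, wordsWithDescents 5 [true, true, false, false]⟩,
   ⟨[2, 2, 1], by decide, rfl,
    [[2, 1, 0, 4, 3], [3, 1, 0, 4, 2], [3, 2, 4, 0, 1], [4, 1, 0, 3, 2], [4, 2, 3, 0, 1]]⟩,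
   ⟨[2, 1, 1, 1], by decide, rfl, wordsWithDescents 5 [true, true, true, false]⟩,
   ⟨[1, 1, 1, 1, 1], by decide, rfl, wordsWithDescents 5 [true, true, true, true]⟩]

theorem isComplete_schurWordsFour : SchurWords.IsComplete schurWordsFour := by
  unfold SchurWords.IsComplete
  decide +kernel

theorem isComplete_schurWordsFive : SchurWords.IsComplete schurWordsFive := by
  unfold SchurWords.IsComplete
  decide +kernel

/-! ## Squares of words -/

section Squares

variable {α β : Type*} [LinearOrder α] [LinearOrder β]

instance (m s t : α) : Decidable (m ∈ Set.uIoo s t) :=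
  decidable_of_iff' _ mem_uIoo_iff

/-- The words which an edge with color `k + 2` of a D₀ graph may join to the given word. If `k` is
the length of `u` and the letter `m` is between `s` and `t`, then these edges join one of the words
`u mst w`, `u tsm w` to one of the words `u mts w`, `u stm w`. -/
def squareMoves : ℕ → List α → List (List α)
  | 0, r :: s :: t :: w =>
      if r ∈ Set.uIoo s t then [r :: t :: s :: w, s :: t :: r :: w]
      else if t ∈ Set.uIoo s r then [t :: r :: s :: w, s :: r :: t :: w] else []
  | k + 1, a :: w => (squareMoves k w).map (a :: ·)
  | _, _ => []

theorem squareMoves_append_left (u : List α) (k : ℕ) (x : List α) :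
    squareMoves (u.length + k) (u ++ x) = (squareMoves k x).map (u ++ ·) := by
  induction u with
  | nil => simp
  | cons a u ih =>
    rw [List.length_cons, Nat.add_right_comm, List.cons_append, squareMoves, ih, List.map_map]
    rfl

theorem squareMoves_append_right (w : List α) {k : ℕ} {x : List α} (hk : k + 3 ≤ x.length) :
    squareMoves k (x ++ w) = (squareMoves k x).map (· ++ w) := by
  fun_induction squareMoves k x with
  | case1 | case2 | case3 => simp [squareMoves, *]
  | case4 k a x ih =>
    rw [List.cons_append, squareMoves, ih (by simpa using hk), List.map_map, List.map_map]
    rfl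
  | case5 k x h0 h1 =>
    match k, x, h0, h1 with
    | 0, r :: s :: t :: w, h0, _ => exact (h0 r s t w rfl rfl).elim
    | k + 1, a :: w, _, h1 => exact (h1 k a w rfl rfl).elim
    | 0, [], _, _ | 0, [_], _, _ | 0, [_, _], _, _ | _ + 1, [], _, _ => simp at hk

theorem squareMoves_map {f : α → β} (hf : StrictMono f ∨ StrictAnti f) (k : ℕ) (x : List α) :
    squareMoves k (x.map f) = (squareMoves k x).map (List.map f) := by
  have hmem : ∀ m s t, f m ∈ Set.uIoo (f s) (f t) ↔ m ∈ Set.uIoo s t := by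
    intro m s t
    rw [mem_uIoo_iff, mem_uIoo_iff]
    rcases hf with hf | hf
    · simp only [hf.lt_iff_lt]
    · simp only [hf.lt_iff_gt]
      tauto
  fun_induction squareMoves k x with
  | case1 | case2 | case3 => simp [squareMoves, *]
  | case4 k a x ih =>
    rw [List.map_cons, squareMoves, ih, List.map_map, List.map_map]
    simp [Function.comp_def]
  | case5 k x h0 h1 =>
    match k, x, h0, h1 with
    | 0, r :: s :: t :: w, h0, _ => exact (h0 r s t w rfl rfl).elim
    | k + 1, a :: w, _, h1 => exact (h1 k a w rfl rfl).elim
    | 0, [], _, _ | 0, [_], _, _ | 0, [_, _], _, _ | _ + 1, [], _, _ => simp [squareMoves]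

theorem squareMoves_eq_pair {u w x : List α} {m s t : α} (hm : m ∈ Set.uIoo s t)
    (hx : x = u ++ m :: s :: t :: w ∨ x = u ++ t :: s :: m :: w) :
    squareMoves u.length x = [u ++ m :: t :: s :: w, u ++ s :: t :: m :: w] := by
  have hm' : t ∉ Set.uIoo s m := by
    rw [mem_uIoo_iff] at hm ⊢
    rintro (h | h) <;> rcases hm with h' | h' <;> order
  rcases hx with rfl | rfl <;> rw [← Nat.add_zero u.length, squareMoves_append_left] <;>
    simp [squareMoves, hm, hm']

theorem mem_squareMoves_iff {k : ℕ} {x y : List α} :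
    y ∈ squareMoves k x ↔ ∃ (u w : List α) (m s t : α), m ∈ Set.uIoo s t ∧ u.length = k ∧
      (x = u ++ m :: s :: t :: w ∨ x = u ++ t :: s :: m :: w) ∧
      (y = u ++ m :: t :: s :: w ∨ y = u ++ s :: t :: m :: w) := by
  constructor
  · intro h
    fun_induction squareMoves k x generalizing y with
    | case1 r s t w hr =>
      exact ⟨[], w, r, s, t, hr, rfl, Or.inl rfl, by simpa using h⟩
    | case2 r s t w _ ht =>
      exact ⟨[], w, t, s, r, ht, rfl, Or.inr rfl, by simpa using h⟩
    | case4 k a x ih =>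
      obtain ⟨y, hy, rfl⟩ := List.mem_map.1 h
      obtain ⟨u, w, m, s, t, hm, hu, hx, hy⟩ := ih hy
      refine ⟨a :: u, w, m, s, t, hm, congrArg (· + 1) hu, ?_, ?_⟩
      · exact hx.imp (congrArg _) (congrArg _)
      · exact hy.imp (congrArg _) (congrArg _)
    | case3 | case5 => exact absurd h List.not_mem_nil
  · rintro ⟨u, w, m, s, t, hm, rfl, hx, hy⟩
    simpa [squareMoves_eq_pair hm hx] using hy

theorem mem_squareMoves_comm {k : ℕ} {x y : List α} :
    y ∈ squareMoves k x ↔ x ∈ squareMoves k y := by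
  have hsymm : ∀ x y : List α, y ∈ squareMoves k x → x ∈ squareMoves k y := by
    intro x y h
    obtain ⟨u, w, m, s, t, hm, hu, hx, hy⟩ := mem_squareMoves_iff.1 h
    exact mem_squareMoves_iff.2 ⟨u, w, m, t, s, Set.uIoo_comm s t ▸ hm, hu, hy, hx⟩
  exact ⟨hsymm x y, hsymm y x⟩

theorem perm_of_mem_squareMoves {k : ℕ} {x y : List α} (h : y ∈ squareMoves k x) : y.Perm x := by
  obtain ⟨u, w, m, s, t, -, -, hx, hy⟩ := mem_squareMoves_iff.1 h
  rcases hx with rfl | rfl <;> rcases hy with rfl | rfl <;> refine List.Perm.append_left u ?_ <;>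
    grind

end Squares

/-- The sign of a D₀ graph at two consecutive letters `r`, `s`. -/
def ordSign {α : Type*} [LinearOrder α] (r s : α) : ℤˣ :=
  if r ≤ s then 1 else -1

section OrdSign

variable {α : Type*} [LinearOrder α] {a b l r m s t : α}

theorem ordSign_swap (h : a ≠ b) : ordSign b a = -ordSign a b := by
  rcases h.lt_or_gt with h | h <;> simp [ordSign, h.le, h.not_ge]

theorem ordSign_eq_of_mem_uIoo (h : m ∈ Set.uIoo s t) :
    ordSign s m = ordSign s t ∧ ordSign m t = ordSign s t := by
  rcases mem_uIoo_iff.1 h with ⟨h, h'⟩ | ⟨h, h'⟩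
  · simp [ordSign, h.le, h'.le, (h.trans h').le]
  · simp [ordSign, h.not_ge, h'.not_ge, (h.trans h').not_ge]

theorem mem_uIoo_of_ordSign_eq_neg (hrs : r ≠ s) (hst : s ≠ t) (hrt : r ≠ t)
    (h : ordSign r s = -ordSign s t) : r ∈ Set.uIoo s t ∨ t ∈ Set.uIoo s r := by
  simp only [mem_uIoo_iff]
  rcases hrs.lt_or_gt with hrs | hrs <;> rcases hst.lt_or_gt with hst | hst
  · simp [ordSign, hrs.le, hst.le] at h
  · rcases hrt.lt_or_gt with hrt | hrt <;> simp [*]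
  · rcases hrt.lt_or_gt with hrt | hrt <;> simp [*]
  · simp [ordSign, hrs.not_ge, hst.not_ge] at h

theorem ordSign_eq_neg_of_left_eq_neg (h : ordSign l a = -ordSign l b) :
    ordSign l a = -ordSign a b := by
  unfold ordSign at *
  split_ifs at * <;> first | order | simp_all

theorem ordSign_eq_neg_of_right_eq_neg (h : ordSign a r = -ordSign b r) :
    ordSign a r = -ordSign b a := by
  unfold ordSign at *
  split_ifs at * <;> first | order | simp_all

/-- The last two conditions say how the outer letters may move; axiom 3 follows from them. -/
theorem exists_letters_of_mem_squareMoves {k : ℕ} {x y : List α} (h : y ∈ squareMoves k x) :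
    ∃ (u w : List α) (a b c a' b' c' : α), u.length = k ∧
      x = u ++ a :: b :: c :: w ∧ y = u ++ a' :: b' :: c' :: w ∧
      ordSign b c = -ordSign a b ∧ ordSign a' b' = -ordSign a b ∧ ordSign b' c' = ordSign a b ∧
      (a = a' ∨ ordSign a a' = ordSign a b) ∧ (c = c' ∨ ordSign c' c = ordSign b c) := by
  obtain ⟨u, w, m, s, t, hm, hu, hx, hy⟩ := mem_squareMoves_iff.1 h
  obtain ⟨hsm, hmt⟩ := ordSign_eq_of_mem_uIoo hm
  have hms : m ≠ s := by rintro rfl; exact Set.left_notMem_uIoo hm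
  have hne : m ≠ t := by rintro rfl; exact Set.right_notMem_uIoo hm
  have hst : s ≠ t := by rintro rfl; simp at hm
  have hms' := ordSign_swap hms.symm
  have htm := ordSign_swap hne
  have hts := ordSign_swap hst
  rcases hx with rfl | rfl <;> rcases hy with rfl | rfl
  all_goals refine ⟨u, w, _, _, _, _, _, _, hu, rfl, rfl, ?_⟩
  all_goals simp [hms', htm, hts, hsm, hmt]

end OrdSign

theorem exists_eq_append_of_add_three_le_length {α : Type*} {k : ℕ} {x : List α}
    (h : k + 3 ≤ x.length) :
    ∃ (u : List α) (r s t : α) (w : List α), u.length = k ∧ x = u ++ r :: s :: t :: w :=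
  ⟨x.take k, x[k], x[k + 1], x[k + 2], x.drop (k + 3), by grind, by simp⟩

namespace D0Graph

variable {N n : ℕ} (G : D0Graph N n)

theorem mem_squareMoves_of_adj {i : ℕ} {x y : G.verts} (h : (G.edge i).Adj x y) :
    y.1 ∈ squareMoves (i - 2) x.1 := by
  have hpair : ∃ (v w : List (Fin N)) (a b c : Fin N), b ∈ Set.uIoo a c ∧ v.length = i - 2 ∧
      ∃ p q : List (Fin N), (p = v ++ b :: a :: c :: w ∨ p = v ++ c :: a :: b :: w) ∧
        (q = v ++ b :: c :: a :: w ∨ q = v ++ a :: c :: b :: w) ∧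
        ({x.1, y.1} : Set (List (Fin N))) = {p, q} := by
    rcases G.isPair i x y h with ⟨v, w, a, b, c, hab, hbc, hv, h | h⟩ |
        ⟨v, w, a, b, c, hab, hbc, hv, h | h⟩ <;>
      refine ⟨v, w, a, b, c, mem_uIoo_iff.2 (Or.inl ⟨hab, hbc⟩), by omega, ?_⟩ <;>
      simp only [List.append_assoc, List.cons_append, List.nil_append] at h
    · exact ⟨_, _, Or.inl rfl, Or.inl rfl, h⟩
    · exact ⟨_, _, Or.inr rfl, Or.inr rfl, h.trans (Set.pair_comm _ _)⟩
    · exact ⟨_, _, Or.inl rfl, Or.inr rfl, h⟩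
    · exact ⟨_, _, Or.inr rfl, Or.inl rfl, h.trans (Set.pair_comm _ _)⟩
  obtain ⟨v, w, a, b, c, hb, hv, p, q, hp, hq, hpq⟩ := hpair
  have hmem : q ∈ squareMoves (i - 2) p := mem_squareMoves_iff.2 ⟨v, w, b, a, c, hb, hv, hp, hq⟩
  rcases Set.pair_eq_pair_iff.1 hpq with ⟨hx, hy⟩ | ⟨hx, hy⟩
  · rwa [hx, hy]
  · rwa [hx, hy, mem_squareMoves_comm]

theorem existsUnique_adj {k : ℕ} {x : G.verts} {y : List (Fin N)}
    (h : y ∈ squareMoves k x.1) : ∃! z, (G.edge (k + 2)).Adj x z := by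
  obtain ⟨u, w, m, s, t, hm, hu, hx, -⟩ := mem_squareMoves_iff.1 h
  rcases mem_uIoo_iff.1 hm with ⟨hsm, hmt⟩ | ⟨htm, hms⟩
  · refine G.existsUnique_edge (k + 2) u w s m t hsm hmt (by omega) x ?_
    rcases hx with hx | hx <;> simp [hx]
  · refine G.existsUnique_edge (k + 2) u w t m s htm hms (by omega) x ?_
    rcases hx with hx | hx <;> simp [hx]

theorem eq_of_adj {i : ℕ} {x y z : G.verts} (hy : (G.edge i).Adj x y) (hz : (G.edge i).Adj x z) :
    y = z := by
  have hi := G.color_mem i x y hy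
  have hunique := G.existsUnique_adj (G.mem_squareMoves_of_adj hy)
  rw [Nat.sub_add_cancel hi.1] at hunique
  exact hunique.unique hy hz

theorem sgn_eq_getElem (x : G.verts) {j : ℕ} (hj : j + 1 < x.1.length) :
    G.toSignedColoredGraph.sgn x (j + 1) = ordSign x.1[j] x.1[j + 1] :=
  dif_pos ⟨Nat.le_add_left 1 j, hj.trans_eq (G.length_eq x.1 x.2)⟩

theorem sgn_eq_ordSign (x : G.verts) {i : ℕ} {p q : List (Fin N)} {r s : Fin N}
    (hx : x.1 = p ++ r :: s :: q) (hi : p.length + 1 = i) :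
    G.toSignedColoredGraph.sgn x i = ordSign r s := by
  subst hi
  rw [G.sgn_eq_getElem x (by simp [hx])]
  simp [hx]

theorem axiom1 : G.toSignedColoredGraph.Axiom1 := by
  refine ⟨fun i v w w' => G.eq_of_adj, fun i x hi hin => ⟨?_, fun h => ?_⟩⟩
  · rintro ⟨y, hxy⟩
    obtain ⟨u, w, a, b, c, a', b', c', hu, hx, -, hsign, -⟩ :=
      exists_letters_of_mem_squareMoves (G.mem_squareMoves_of_adj hxy)
    rw [G.sgn_eq_ordSign x hx (by omega),
      G.sgn_eq_ordSign x (p := u ++ [a]) (by simpa using hx) (by grind), hsign, neg_neg]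
  · obtain ⟨k, rfl⟩ := Nat.exists_eq_add_of_le' hi
    obtain ⟨u, r, s, t, w, rfl, hx⟩ := exists_eq_append_of_add_three_le_length
      (hin.trans_eq (G.length_eq x.1 x.2).symm)
    rw [G.sgn_eq_ordSign x hx (by omega),
      G.sgn_eq_ordSign x (p := u ++ [r]) (by simpa using hx) (by simp)] at h
    have hnodup : [r, s, t].Nodup :=
      (G.nodup x.1 x.2).sublist (hx ▸ ((List.prefix_append [r, s, t] w).sublist.trans
        (List.sublist_append_right u _)))
    obtain ⟨⟨hrs, hrt⟩, hst⟩ : (r ≠ s ∧ r ≠ t) ∧ s ≠ t := by simpa using hnodup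
    obtain ⟨y, hy⟩ : ∃ y, y ∈ squareMoves u.length x.1 := by
      simp only [mem_squareMoves_iff]
      rcases mem_uIoo_of_ordSign_eq_neg hrs hst hrt h with hr | ht
      · exact ⟨_, u, w, r, s, t, hr, rfl, Or.inl hx, Or.inl rfl⟩
      · exact ⟨_, u, w, t, s, r, ht, rfl, Or.inr hx, Or.inl rfl⟩
    exact (G.existsUnique_adj hy).exists

theorem axiom2 : G.toSignedColoredGraph.Axiom2 := by
  intro i x y hxy
  have hi := G.color_mem i x y hxy
  have hmoves := G.mem_squareMoves_of_adj hxy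
  obtain ⟨u, w, a, b, c, a', b', c', hu, hx, hy, hbc, hab', hbc', -⟩ :=
    exists_letters_of_mem_squareMoves hmoves
  refine ⟨?_, ?_, fun h h1 hn hh => ?_⟩
  · rw [G.sgn_eq_ordSign x hx (by omega), G.sgn_eq_ordSign y hy (by omega), hab', neg_neg]
  · rw [G.sgn_eq_ordSign x (p := u ++ [a]) (by simpa using hx) (by grind),
      G.sgn_eq_ordSign y (p := u ++ [a']) (by simpa using hy) (by grind), hbc, hbc']
  · obtain ⟨j, rfl⟩ := Nat.exists_eq_add_of_le' h1
    have hlx := G.length_eq x.1 x.2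
    have hly := G.length_eq y.1 y.2
    have hletter : ∀ m (hm : m < n), (m < u.length ∨ u.length + 3 ≤ m) → x.1[m] = y.1[m] := by
      rintro m hm (hmu | hmu)
      · simp only [hx, hy, List.getElem_append_left hmu]
      · obtain ⟨m, rfl⟩ := Nat.exists_eq_add_of_le hmu
        simp [hx, hy, List.getElem_append_right, Nat.add_assoc, Nat.add_comm 3]
    rw [G.sgn_eq_getElem x (by omega), G.sgn_eq_getElem y (by omega),
      hletter j (by omega) (by omega), hletter (j + 1) (by omega) (by omega)]

theorem axiom3 : G.toSignedColoredGraph.Axiom3 := by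
  intro i x y hxy
  have hi := G.color_mem i x y hxy
  obtain ⟨u, w, a, b, c, a', b', c', hu, hx, hy, -, -, -, ha, hc⟩ :=
    exists_letters_of_mem_squareMoves (G.mem_squareMoves_of_adj hxy)
  refine ⟨fun hi3 h => ?_, fun hin h => ?_⟩
  · obtain ⟨v, l, rfl⟩ : ∃ v l, u = v ++ [l] :=
      ⟨_, _, (List.dropLast_append_getLast (List.ne_nil_of_length_pos (by omega))).symm⟩
    rw [List.length_append, List.length_singleton] at hu
    simp only [List.append_assoc, List.cons_append, List.nil_append] at hx hy
    rw [G.sgn_eq_ordSign x hx (by omega), G.sgn_eq_ordSign y hy (by omega)] at h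
    rw [G.sgn_eq_ordSign x hx (by omega),
      G.sgn_eq_ordSign x (p := v ++ [l]) (by simpa using hx) (by grind)]
    rcases ha with rfl | ha
    · exact absurd h (units_ne_neg_self _)
    · rw [← ha, ordSign_eq_neg_of_left_eq_neg h]
  · obtain ⟨r, w, rfl⟩ : ∃ r w', w = r :: w' := by
      refine List.exists_cons_of_length_pos ?_
      have hlx := G.length_eq x.1 x.2
      simp only [hx, List.length_append, List.length_cons] at hlx
      omega
    have hxr := G.sgn_eq_ordSign x (i := i + 1) (p := u ++ [a, b]) (by simpa using hx)
      (by grind)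
    have hyr := G.sgn_eq_ordSign y (i := i + 1) (p := u ++ [a', b']) (by simpa using hy)
      (by grind)
    rw [hxr, hyr] at h
    rw [hxr, G.sgn_eq_ordSign x (p := u ++ [a]) (by simpa using hx) (by grind)]
    rcases hc with rfl | hc
    · exact absurd h (units_ne_neg_self _)
    · rw [← hc, ordSign_eq_neg_of_right_eq_neg h]

end D0Graph

/-! ## Restrictions to windows -/

section Windows

variable {α β : Type*} {u t : List β} {ℓ : α → β}

/-- The word with the letters `ℓ p₀, ℓ p₁, …` in the window between `u` and `t`. -/
def embedWord (u : List β) (ℓ : α → β) (t : List β) (p : List α) : List β :=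
  u ++ p.map ℓ ++ t

theorem embedWord_injective (hℓ : Function.Injective ℓ) :
    Function.Injective (embedWord u ℓ t) := fun _ _ h =>
  hℓ.list_map (List.append_cancel_left (List.append_cancel_right h))

theorem length_embedWord (p : List α) :
    (embedWord u ℓ t p).length = u.length + p.length + t.length := by
  rw [embedWord, List.length_append, List.length_append, List.length_map]

theorem getElem_embedWord {p : List α} {k : ℕ} (hk : k < p.length) :
    (embedWord u ℓ t p)[u.length + k]'(by rw [length_embedWord]; omega) = ℓ p[k] := by
  simp [embedWord, hk]

theorem squareMoves_embedWord [LinearOrder α] [LinearOrder β] (hℓ : StrictMono ℓ ∨ StrictAnti ℓ)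
    {k : ℕ} {p : List α} (hk : k + 3 ≤ p.length) :
    squareMoves (u.length + k) (embedWord u ℓ t p) = (squareMoves k p).map (embedWord u ℓ t) := by
  rw [embedWord, List.append_assoc, squareMoves_append_left,
    squareMoves_append_right t (by rwa [List.length_map]), squareMoves_map hℓ, List.map_map,
    List.map_map]
  simp [Function.comp_def, embedWord]

theorem exists_strictMono_map_eq [LinearOrder β] {w : List β} {d : ℕ} (hw : w.Nodup)
    (hd : w.length = d) :
    ∃ (ℓ : Fin d → β) (p : List (Fin d)), StrictMono ℓ ∧ p ∈ permWords d ∧ p.map ℓ = w := by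
  have hcard : w.toFinset.card = d := by rw [List.toFinset_card_of_nodup hw, hd]
  have hmono := (w.toFinset.orderEmbOfFin hcard).strictMono
  have hperm : w.Perm ((List.finRange d).map (w.toFinset.orderEmbOfFin hcard)) := by
    refine (List.perm_ext_iff_of_nodup hw ?_).2 fun a => ?_
    · exact (List.nodup_finRange d).map hmono.injective
    · rw [← List.mem_toFinset, ← Finset.mem_coe, ← Finset.range_orderEmbOfFin _ hcard]
      simp
  rw [← List.mem_permutations', ← List.map_permutations'] at hperm
  obtain ⟨p, hp, hpw⟩ := List.mem_map.1 hperm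
  exact ⟨_, p, hmono, hp, hpw⟩

end Windows

namespace SignedColoredGraph

variable {n : ℕ} {V : Type*} (G : SignedColoredGraph n V)

theorem graph_adj {v w : V} : G.graph.Adj v w ↔ ∃ i, (G.edge i).Adj v w :=
  SimpleGraph.iSup_adj

theorem res_edge_adj {a d s : ℕ} {v w : V} :
    ((G.res a d).edge s).Adj v w ↔ 2 ≤ s ∧ s < d ∧ (G.edge (s + a - 1)).Adj v w := by
  by_cases hs : 2 ≤ s ∧ s < d
  · simp [res, hs]
  · simp only [res, if_neg hs, SimpleGraph.bot_adj, false_iff]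
    tauto

theorem connectedComponentMk_res_eq_of_adj {a d s : ℕ} {v w : V} (hs : 2 ≤ s) (hsd : s < d)
    (h : (G.edge (s + a - 1)).Adj v w) :
    (G.res a d).graph.connectedComponentMk v = (G.res a d).graph.connectedComponentMk w :=
  SimpleGraph.ConnectedComponent.connectedComponentMk_eq_of_adj
    ((graph_adj _).2 ⟨s, G.res_edge_adj.2 ⟨hs, hsd, h⟩⟩)

end SignedColoredGraph

namespace D0Graph

variable {N n : ℕ} (G : D0Graph N n)

theorem sgn_embedWord {α : Type*} {u t : List (Fin N)} {ℓ : α → Fin N} {x : G.verts}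
    {p : List α} (hx : x.1 = embedWord u ℓ t p) {k : ℕ} (hk : k + 1 < p.length) :
    G.toSignedColoredGraph.sgn x (u.length + k + 1) = ordSign (ℓ p[k]) (ℓ p[k + 1]) := by
  rw [G.sgn_eq_getElem x (by rw [hx, length_embedWord]; omega)]
  simp only [hx, Nat.add_assoc, getElem_embedWord, hk, k.lt_succ_self.trans hk]

section Embedded

variable {α : Type*} [LinearOrder α] {u t : List (Fin N)} {ℓ : α → Fin N}

theorem exists_mem_squareMoves_of_adj_embedWord (hℓ : StrictMono ℓ ∨ StrictAnti ℓ) {k : ℕ}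
    {x y : G.verts} {p : List α} (hk : k + 3 ≤ p.length) (hx : x.1 = embedWord u ℓ t p)
    (h : (G.edge (u.length + k + 2)).Adj x y) :
    ∃ q ∈ squareMoves k p, y.1 = embedWord u ℓ t q := by
  have hy := G.mem_squareMoves_of_adj h
  rw [Nat.add_sub_cancel, hx, squareMoves_embedWord hℓ hk, List.mem_map] at hy
  exact hy.imp fun q hq => ⟨hq.1, hq.2.symm⟩

theorem exists_adj_embedWord (hℓ : StrictMono ℓ ∨ StrictAnti ℓ) {k : ℕ} {x : G.verts}
    {p : List α} (hk : k + 3 ≤ p.length) (hx : x.1 = embedWord u ℓ t p)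
    (h : squareMoves k p ≠ []) :
    ∃ y, (G.edge (u.length + k + 2)).Adj x y ∧ ∃ q ∈ squareMoves k p, y.1 = embedWord u ℓ t q := by
  obtain ⟨q, hq⟩ := List.exists_mem_of_ne_nil _ h
  have hmem : embedWord u ℓ t q ∈ squareMoves (u.length + k) x.1 := by
    rw [hx, squareMoves_embedWord hℓ hk]
    exact List.mem_map_of_mem hq
  obtain ⟨y, hy, -⟩ := G.existsUnique_adj hmem
  exact ⟨y, hy, G.exists_mem_squareMoves_of_adj_embedWord hℓ hk hx hy⟩

theorem exists_perm_of_reachable_res (hℓ : StrictMono ℓ ∨ StrictAnti ℓ) {x y : G.verts}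
    {p : List α} (hx : x.1 = embedWord u ℓ t p)
    (h : (G.toSignedColoredGraph.res (u.length + 1) p.length).graph.Reachable x y) :
    ∃ q, q.Perm p ∧ y.1 = embedWord u ℓ t q := by
  rw [SimpleGraph.reachable_iff_reflTransGen] at h
  induction h with
  | refl => exact ⟨p, .rfl, hx⟩
  | @tail y z _ hyz ih =>
    obtain ⟨q, hq, hy⟩ := ih
    obtain ⟨s, hs⟩ := (SignedColoredGraph.graph_adj _).1 hyz
    obtain ⟨hs2, hsd, hadj⟩ := (SignedColoredGraph.res_edge_adj _).1 hs
    rw [show s + (u.length + 1) - 1 = u.length + (s - 2) + 2 by omega] at hadj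
    obtain ⟨q', hq', hz⟩ := G.exists_mem_squareMoves_of_adj_embedWord hℓ
      (by rw [hq.length_eq]; omega) hy hadj
    exact ⟨q', (perm_of_mem_squareMoves hq').trans hq, hz⟩

theorem fundamentalQSym_descents_res (hℓ : StrictMono ℓ) {x : G.verts} {p : List α} {d : ℕ}
    (hx : x.1 = embedWord u ℓ t p) (hd : p.length = d) :
    fundamentalQSym d ((G.toSignedColoredGraph.res (u.length + 1) d).descents x) =
      qsymOfBits d (wordDescents p) := by
  rw [wordDescents, qsymOfBits_descentBits _ hd]
  refine congrArg _ (Set.ext fun s => ?_)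
  change G.toSignedColoredGraph.sgn x (s + (u.length + 1)) = -1 ↔ p[(s : ℕ) + 1] < p[(s : ℕ)]
  rw [show (s : ℕ) + (u.length + 1) = u.length + s + 1 by omega,
    G.sgn_embedWord hx (by omega), ordSign]
  split_ifs with h <;> simpa [hℓ.le_iff_le] using h

theorem exists_eq_embedWord (x : G.verts) {a d : ℕ} (h : a + d ≤ n) :
    ∃ (u : List (Fin N)) (ℓ : Fin d → Fin N) (t : List (Fin N)) (p : List (Fin d)),
      u.length = a ∧ StrictMono ℓ ∧ p ∈ permWords d ∧ x.1 = embedWord u ℓ t p := by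
  have hx := G.length_eq x.1 x.2
  have hsplit : x.1.take a ++ (x.1.drop a).take d ++ (x.1.drop a).drop d = x.1 := by
    rw [List.append_assoc, List.take_append_drop, List.take_append_drop]
  obtain ⟨ℓ, p, hℓ, hp, hpw⟩ := exists_strictMono_map_eq (w := (x.1.drop a).take d) (d := d)
    ((G.nodup x.1 x.2).sublist ((List.take_sublist _ _).trans (List.drop_sublist _ _)))
    (by grind)
  exact ⟨x.1.take a, ℓ, (x.1.drop a).drop d, p, by grind, hℓ, hp,
    by rw [embedWord, hpw, hsplit]⟩

end Embedded

/-- The number of vertices in `S` that are the image of `p` under an embedding `e` of words. -/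
def wordCount {α : Type*} (S : Finset G.verts) (e : List α → List (Fin N)) (p : List α) : ℕ :=
  Finset.card {v ∈ S | v.1 = e p}

theorem wordCount_add_wordCount {α : Type*} {S : Finset G.verts} {e : List α → List (Fin N)}
    (he : Function.Injective e) {p q : List α} (hpq : p ≠ q) :
    G.wordCount S e p + G.wordCount S e q = Finset.card {v ∈ S | v.1 = e p ∨ v.1 = e q} := by
  rw [wordCount, wordCount, Finset.filter_or, Finset.card_union_of_disjoint]
  exact Finset.disjoint_filter.2 fun v _ hp hq => hpq (he (hp.symm.trans hq))

section Count

variable {α : Type*} [LinearOrder α] {u t : List (Fin N)} {ℓ : α → Fin N} {S : Finset G.verts}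

theorem wordCount_add_le (hℓ : StrictMono ℓ)
    (hS : ∀ x ∈ S, ∀ y i, u.length + 2 ≤ i → i + t.length < n → (G.edge i).Adj x y → y ∈ S)
    (v w : List α) {m r s : α} (hm : m ∈ Set.uIoo r s) :
    G.wordCount S (embedWord u ℓ t) (v ++ m :: r :: s :: w) +
        G.wordCount S (embedWord u ℓ t) (v ++ s :: r :: m :: w) ≤
      G.wordCount S (embedWord u ℓ t) (v ++ m :: s :: r :: w) +
        G.wordCount S (embedWord u ℓ t) (v ++ r :: s :: m :: w) := by
  have hmr : m ≠ r := by rintro rfl; exact Set.left_notMem_uIoo hm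
  have hms : m ≠ s := by rintro rfl; exact Set.right_notMem_uIoo hm
  rw [G.wordCount_add_wordCount (embedWord_injective hℓ.injective) (by simp [hms]),
    G.wordCount_add_wordCount (embedWord_injective hℓ.injective) (by simp [hmr])]
  refine Finset.card_le_card_of_forall_subsingleton
    (fun x y => (G.edge (u.length + v.length + 2)).Adj x y) (fun x hx => ?_)
    fun y _ x hx x' hx' => G.eq_of_adj hx.2.symm hx'.2.symm
  obtain ⟨hxS, hx⟩ := Finset.mem_filter.1 hx
  obtain ⟨p, hp, hxp, hlen⟩ : ∃ p, squareMoves v.length p =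
      [v ++ m :: s :: r :: w, v ++ r :: s :: m :: w] ∧ x.1 = embedWord u ℓ t p ∧
      p.length = v.length + 3 + w.length := by
    rcases hx with hx | hx
    · exact ⟨_, squareMoves_eq_pair hm (Or.inl rfl), hx, by grind⟩
    · exact ⟨_, squareMoves_eq_pair hm (Or.inr rfl), hx, by grind⟩
  obtain ⟨y, hxy, q, hq, hy⟩ := G.exists_adj_embedWord (Or.inl hℓ) (by omega) hxp
    (hp ▸ List.cons_ne_nil _ _)
  have hn : u.length + p.length + t.length = n := by
    rw [← length_embedWord (ℓ := ℓ), ← hxp, G.length_eq x.1 x.2]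
  refine ⟨y, Finset.mem_filter.2 ⟨hS x hxS y _ (by omega) (by omega) hxy, ?_⟩, hxy⟩
  rw [hp] at hq
  rcases List.mem_pair.1 hq with rfl | rfl
  · exact Or.inl hy
  · exact Or.inr hy

theorem isBalanced_wordCount (hℓ : StrictMono ℓ)
    (hS : ∀ x ∈ S, ∀ y i, u.length + 2 ≤ i → i + t.length < n → (G.edge i).Adj x y → y ∈ S) :
    IsBalanced (G.wordCount S (embedWord u ℓ t)) := fun v w _ r s hm =>
  le_antisymm (G.wordCount_add_le hℓ hS v w hm)
    (G.wordCount_add_le hℓ hS v w (Set.uIoo_comm r s ▸ hm))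

theorem sum_fundamentalQSym_eq_sum_wordCount {d : ℕ} {ℓ : Fin d → Fin N} (hℓ : StrictMono ℓ)
    (hS : ∀ x ∈ S, ∃ p ∈ permWords d, x.1 = embedWord u ℓ t p) :
    ∑ x ∈ S, fundamentalQSym d ((G.toSignedColoredGraph.res (u.length + 1) d).descents x) =
      ((permWords d).map fun p =>
        G.wordCount S (embedWord u ℓ t) p • qsymOfBits d (wordDescents p)).sum := by
  choose! word hword using hS
  rw [← List.sum_toFinset _ (nodup_permWords d), ← Finset.sum_fiberwise_of_maps_to
    (fun x hx => List.mem_toFinset.2 (hword x hx).1)]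
  refine Finset.sum_congr rfl fun p hp => ?_
  have hp := length_of_mem_permWords (List.mem_toFinset.1 hp)
  have hfiber : ∀ x ∈ S, word x = p ↔ x.1 = embedWord u ℓ t p := fun x hx =>
    ⟨fun h => h ▸ (hword x hx).2, fun h =>
      embedWord_injective hℓ.injective ((hword x hx).2.symm.trans h)⟩
  rw [Finset.filter_congr hfiber, Finset.sum_congr rfl fun x hx =>
    G.fundamentalQSym_descents_res hℓ (Finset.mem_filter.1 hx).2 hp, Finset.sum_const]
  rfl

end Count

open Classical in
theorem lsp_of_isComplete {d : ℕ} {l : List (SchurWords d)} (hl : SchurWords.IsComplete l) :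
    G.toSignedColoredGraph.LSP d := by
  intro a ha had C
  induction C using SimpleGraph.ConnectedComponent.ind with | _ x
  obtain ⟨u, ℓ, t, p, hu, hℓ, hp, hx⟩ := G.exists_eq_embedWord x (a := a - 1) (d := d) (by omega)
  obtain rfl : u.length + 1 = a := by omega
  have hpd := length_of_mem_permWords hp
  have hn : u.length + d + t.length = n := by
    rw [← hpd, ← length_embedWord (ℓ := ℓ), ← hx, G.length_eq x.1 x.2]
  rw [SignedColoredGraph.componentGenFun,
    G.sum_fundamentalQSym_eq_sum_wordCount (t := t) hℓ fun y hy => ?_]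
  · refine (G.isBalanced_wordCount hℓ fun y hy z i hi hin hyz => ?_).schurPositive hl
    rw [Finset.mem_filter_univ] at hy ⊢
    rw [← hy, eq_comm]
    refine SignedColoredGraph.connectedComponentMk_res_eq_of_adj _ (s := i - u.length) (by omega)
      (by omega) ?_
    rwa [show i - u.length + (u.length + 1) - 1 = i by omega]
  · rw [Finset.mem_filter_univ, SimpleGraph.ConnectedComponent.eq] at hy
    obtain ⟨q, hq, hyq⟩ := G.exists_perm_of_reachable_res (Or.inl hℓ) hx (hpd ▸ hy.symm)
    exact ⟨q, mem_permWords.2 (hq.trans (mem_permWords.1 hp)), hyq⟩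

theorem lsp_four : G.toSignedColoredGraph.LSP 4 :=
  G.lsp_of_isComplete isComplete_schurWordsFour

theorem lsp_five : G.toSignedColoredGraph.LSP 5 :=
  G.lsp_of_isComplete isComplete_schurWordsFive

end D0Graph

/-! ## Alternating paths -/

namespace SignedColoredGraph

variable {n : ℕ} {V : Type*} {G : SignedColoredGraph n V}

theorem admitsNeighbor_res {a d s : ℕ} {v : V} :
    (G.res a d).AdmitsNeighbor s v ↔ 2 ≤ s ∧ s < d ∧ G.AdmitsNeighbor (s + a - 1) v := by
  simp only [AdmitsNeighbor, res_edge_adj, exists_and_left]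

theorem sgn_res {a d s : ℕ} (h1 : 1 ≤ s) (hd : s < d) (v : V) :
    (G.res a d).sgn v s = G.sgn v (s + a - 1) := by
  rw [sgn, dif_pos ⟨h1, hd⟩, Nat.sub_add_comm h1]
  rfl

theorem Axiom0.res (h : G.Axiom0) (a d : ℕ) : (G.res a d).Axiom0 := fun _ v w w' hw hw' =>
  h _ v w w' ((G.res_edge_adj).1 hw).2.2 ((G.res_edge_adj).1 hw').2.2

theorem Axiom1.res (h : G.Axiom1) {a d : ℕ} (ha : 1 ≤ a) (had : a + d ≤ n + 1) :
    (G.res a d).Axiom1 := by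
  refine ⟨h.1.res a d, fun i v hi hid => ?_⟩
  rw [admitsNeighbor_res, sgn_res (by omega) (by omega), sgn_res (by omega) hid,
    h.2 (i + a - 1) v (by omega) (by omega), show i - 1 + a - 1 = i + a - 1 - 1 by omega]
  exact ⟨fun h => h.2.2, fun h => ⟨hi, hid, h⟩⟩

theorem Axiom2.res (h : G.Axiom2) {a d : ℕ} (ha : 1 ≤ a) (had : a + d ≤ n + 1) :
    (G.res a d).Axiom2 := by
  intro i v w hvw
  obtain ⟨hi, hid, hadj⟩ := G.res_edge_adj.1 hvw
  obtain ⟨hleft, hright, hfar⟩ := h _ v w hadj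
  refine ⟨?_, ?_, fun k hk hkd hki => ?_⟩
  · simpa only [sgn_res (show 1 ≤ i - 1 by omega) (show i - 1 < d by omega),
      show i - 1 + a - 1 = i + a - 1 - 1 by omega] using hleft
  · simpa only [sgn_res (show 1 ≤ i by omega) hid] using hright
  · simpa only [sgn_res hk hkd] using hfar (k + a - 1) (by omega) (by omega) (by omega)

/-- The `i`-edges and `j`-edges at the vertices `x₁, …, x₅` are those of a path with the colors
`i`, `j`, `i`, `j`. -/
structure IsAlternatingPath (G : SignedColoredGraph n V) (i j : ℕ) (x₁ x₂ x₃ x₄ x₅ : V) :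
    Prop where
  adj₁₂ : (G.edge i).Adj x₁ x₂
  adj₂₃ : (G.edge j).Adj x₂ x₃
  adj₃₄ : (G.edge i).Adj x₃ x₄
  adj₄₅ : (G.edge j).Adj x₄ x₅
  left_end : ¬ G.AdmitsNeighbor j x₁
  right_end : ¬ G.AdmitsNeighbor i x₅

namespace IsAlternatingPath

variable {x₁ x₂ x₃ x₄ x₅ : V}

theorem symm {i j : ℕ} (h : G.IsAlternatingPath i j x₁ x₂ x₃ x₄ x₅) :
    G.IsAlternatingPath j i x₅ x₄ x₃ x₂ x₁ :=
  ⟨h.adj₄₅.symm, h.adj₃₄.symm, h.adj₂₃.symm, h.adj₁₂.symm, h.right_end, h.left_end⟩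

theorem res {a : ℕ} (h : G.IsAlternatingPath (a + 1) (a + 2) x₁ x₂ x₃ x₄ x₅) :
    (G.res a 4).IsAlternatingPath 2 3 x₁ x₂ x₃ x₄ x₅ := by
  have h₂ : a + 1 = 2 + a - 1 := by omega
  have h₃ : a + 2 = 3 + a - 1 := by omega
  rw [h₂, h₃] at h
  exact ⟨G.res_edge_adj.2 ⟨by decide, by decide, h.adj₁₂⟩,
    G.res_edge_adj.2 ⟨by decide, by decide, h.adj₂₃⟩,
    G.res_edge_adj.2 ⟨by decide, by decide, h.adj₃₄⟩,
    G.res_edge_adj.2 ⟨by decide, by decide, h.adj₄₅⟩,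
    fun hx => h.left_end (admitsNeighbor_res.1 hx).2.2,
    fun hx => h.right_end (admitsNeighbor_res.1 hx).2.2⟩

variable {H : SignedColoredGraph 4 V}

theorem reachable_iff (h : H.IsAlternatingPath 2 3 x₁ x₂ x₃ x₄ x₅) (h0 : H.Axiom0) {v : V} :
    H.graph.Reachable x₃ v ↔ v ∈ [x₁, x₂, x₃, x₄, x₅] := by
  have hreach : ∀ {i x y}, (H.edge i).Adj x y → H.graph.Reachable x y := fun hxy =>
    (H.graph_adj.2 ⟨_, hxy⟩).reachable
  constructor
  · rw [SimpleGraph.reachable_iff_reflTransGen]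
    intro hv
    induction hv with
    | refl => simp
    | @tail y z _ hyz hy =>
      obtain ⟨i, hyz⟩ := H.graph_adj.1 hyz
      have hi := H.color_mem i y z hyz
      obtain rfl | rfl : i = 2 ∨ i = 3 := by omega
      all_goals
        simp only [List.mem_cons, List.not_mem_nil, or_false] at hy ⊢
        rcases hy with rfl | rfl | rfl | rfl | rfl
      · exact .inr (.inl (h0 2 _ _ _ hyz h.adj₁₂))
      · exact .inl (h0 2 _ _ _ hyz h.adj₁₂.symm)
      · exact .inr (.inr (.inr (.inl (h0 2 _ _ _ hyz h.adj₃₄))))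
      · exact .inr (.inr (.inl (h0 2 _ _ _ hyz h.adj₃₄.symm)))
      · exact (h.right_end ⟨z, hyz⟩).elim
      · exact (h.left_end ⟨z, hyz⟩).elim
      · exact .inr (.inr (.inl (h0 3 _ _ _ hyz h.adj₂₃)))
      · exact .inr (.inl (h0 3 _ _ _ hyz h.adj₂₃.symm))
      · exact .inr (.inr (.inr (.inr (h0 3 _ _ _ hyz h.adj₄₅))))
      · exact .inr (.inr (.inr (.inl (h0 3 _ _ _ hyz h.adj₄₅.symm))))
  · have hx₂ := hreach h.adj₂₃.symm
    have hx₄ := hreach h.adj₃₄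
    simp only [List.mem_cons, List.not_mem_nil, or_false]
    rintro (rfl | rfl | rfl | rfl | rfl)
    · exact hx₂.trans (hreach h.adj₁₂.symm)
    · exact hx₂
    · exact .refl _
    · exact hx₄
    · exact hx₄.trans (hreach h.adj₄₅)

theorem signature_eq (h : H.IsAlternatingPath 2 3 x₁ x₂ x₃ x₄ x₅) (h1 : H.Axiom1)
    (h2 : H.Axiom2) {δ : ℤˣ} (hδ : H.sgn x₃ 1 = δ) :
    H.signature x₁ = ![δ, -δ, -δ] ∧ H.signature x₂ = ![-δ, δ, -δ] ∧
      H.signature x₃ = ![δ, -δ, δ] ∧ H.signature x₄ = ![-δ, δ, -δ] ∧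
      H.signature x₅ = ![-δ, -δ, δ] := by
  have halt₂ : ∀ {v w}, (H.edge 2).Adj v w → H.signature v 1 = -H.signature v 0 := fun hvw =>
    neg_eq_iff_eq_neg.1 ((h1.2 2 _ le_rfl (by decide)).1 ⟨_, hvw⟩).symm
  have halt₃ : ∀ {v w}, (H.edge 3).Adj v w → H.signature v 2 = -H.signature v 1 := fun hvw =>
    neg_eq_iff_eq_neg.1 ((h1.2 3 _ (by decide) (by decide)).1 ⟨_, hvw⟩).symm
  have hflip₂ : ∀ {v w}, (H.edge 2).Adj v w → H.signature w 0 = -H.signature v 0 := fun hvw =>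
    (h2 2 _ _ hvw.symm).1
  have hflip₃ : ∀ {v w}, (H.edge 3).Adj v w → H.signature w 1 = -H.signature v 1 := fun hvw =>
    (h2 3 _ _ hvw.symm).1
  have hend₂ : H.signature x₅ 0 = H.signature x₅ 1 := neg_neg (H.signature x₅ 1) ▸
    Int.units_ne_iff_eq_neg.1 fun he => h.right_end ((h1.2 2 _ le_rfl (by decide)).2 he)
  have hend₃ : H.signature x₁ 2 = H.signature x₁ 1 := Eq.symm <| neg_neg (H.signature x₁ 2) ▸
    Int.units_ne_iff_eq_neg.1 fun he => h.left_end ((h1.2 3 _ (by decide) (by decide)).2 he)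
  have hvec : ∀ {v a b c}, H.signature v 0 = a → H.signature v 1 = b → H.signature v 2 = c →
      H.signature v = ![a, b, c] := by
    rintro v _ _ _ rfl rfl rfl
    exact List.ofFn_injective rfl
  have h₃ : H.signature x₃ 0 = δ := hδ
  have h₃' : H.signature x₃ 1 = -δ := by rw [halt₂ h.adj₃₄, h₃]
  have h₂' : H.signature x₂ 1 = δ := by rw [hflip₃ h.adj₂₃.symm, h₃', neg_neg]
  have h₂ : H.signature x₂ 0 = -δ := by rw [← h₂', halt₂ h.adj₁₂.symm, neg_neg]
  have h₁ : H.signature x₁ 0 = δ := by rw [hflip₂ h.adj₁₂.symm, h₂, neg_neg]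
  have h₁' : H.signature x₁ 1 = -δ := by rw [halt₂ h.adj₁₂, h₁]
  have h₄ : H.signature x₄ 0 = -δ := by rw [hflip₂ h.adj₃₄, h₃]
  have h₄' : H.signature x₄ 1 = δ := by rw [halt₂ h.adj₃₄.symm, h₄, neg_neg]
  have h₅' : H.signature x₅ 1 = -δ := by rw [hflip₃ h.adj₄₅, h₄']
  exact ⟨hvec h₁ h₁' (hend₃.trans h₁'), hvec h₂ h₂' (by rw [halt₃ h.adj₂₃, h₂']),
    hvec h₃ h₃' (by rw [halt₃ h.adj₂₃.symm, h₃', neg_neg]),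
    hvec h₄ h₄' (by rw [halt₃ h.adj₄₅, h₄']),
    hvec (hend₂.trans h₅') h₅' (by rw [halt₃ h.adj₄₅.symm, h₅', neg_neg])⟩

theorem nodup (h : H.IsAlternatingPath 2 3 x₁ x₂ x₃ x₄ x₅) (h1 : H.Axiom1) (h2 : H.Axiom2) :
    [x₁, x₂, x₃, x₄, x₅].Nodup := by
  obtain ⟨hx₁, hx₂, hx₃, hx₄, hx₅⟩ := h.signature_eq h1 h2 rfl
  have hsign : ∀ δ : ℤˣ,
      [![δ, -δ, -δ], ![-δ, δ, -δ], ![δ, -δ, δ], ![-δ, -δ, δ]].Nodup := by decide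
  have h₁₂₃₅ : [x₁, x₂, x₃, x₅].Nodup := .of_map H.signature (by simp [*])
  have h₁₄₃₅ : [x₁, x₄, x₃, x₅].Nodup := .of_map H.signature (by simp [*])
  have h₂₄ : x₂ ≠ x₄ := by
    rintro rfl
    have h₁₃ := h1.1 2 _ _ _ h.adj₁₂.symm h.adj₃₄.symm
    simp [h₁₃] at h₁₂₃₅
  grind

theorem componentGenFun_eq [Fintype V] (h : H.IsAlternatingPath 2 3 x₁ x₂ x₃ x₄ x₅)
    (h1 : H.Axiom1) (h2 : H.Axiom2) {δ : ℤˣ} (hδ : H.sgn x₃ 1 = δ) :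
    H.componentGenFun (H.graph.connectedComponentMk x₃) =
      ([![δ, -δ, -δ], ![-δ, δ, -δ], ![δ, -δ, δ], ![-δ, δ, -δ], ![-δ, -δ, δ]].map
        fun σ => fundamentalQSym 4 {s | σ s = -1}).sum := by
  classical
  obtain ⟨hx₁, hx₂, hx₃, hx₄, hx₅⟩ := h.signature_eq h1 h2 hδ
  have hcomp : ({v | H.graph.connectedComponentMk v = H.graph.connectedComponentMk x₃} : Finset V) =
      [x₁, x₂, x₃, x₄, x₅].toFinset := by
    ext v
    rw [Finset.mem_filter_univ, List.mem_toFinset, ← h.reachable_iff h1.1,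
      SimpleGraph.ConnectedComponent.eq, SimpleGraph.reachable_comm]
  rw [componentGenFun, hcomp, List.sum_toFinset _ (h.nodup h1 h2)]
  simp [descents, hx₁, hx₂, hx₃, hx₄, hx₅]

theorem componentGenFun_res_congr [Fintype V] (h1 : G.Axiom1) (h2 : G.Axiom2) {a b : ℕ}
    {y₁ y₂ y₃ y₄ y₅ : V} (h : G.IsAlternatingPath (a + 1) (a + 2) x₁ x₂ x₃ x₄ x₅)
    (h' : G.IsAlternatingPath (b + 1) (b + 2) y₁ y₂ y₃ y₄ y₅) (ha : 1 ≤ a) (hb : 1 ≤ b)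
    (hsgn : G.sgn x₃ a = G.sgn y₃ b) :
    (G.res a 4).componentGenFun ((G.res a 4).graph.connectedComponentMk x₃) =
      (G.res b 4).componentGenFun ((G.res b 4).graph.connectedComponentMk y₃) := by
  have han := (G.color_mem _ _ _ h.adj₂₃).2
  have hbn := (G.color_mem _ _ _ h'.adj₂₃).2
  have hx : (G.res a 4).sgn x₃ 1 = G.sgn y₃ b := by
    rw [sgn_res le_rfl (by decide), Nat.add_sub_cancel_left, hsgn]
  have hy : (G.res b 4).sgn y₃ 1 = G.sgn y₃ b := by
    rw [sgn_res le_rfl (by decide), Nat.add_sub_cancel_left]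
  rw [h.res.componentGenFun_eq (h1.res ha (by omega)) (h2.res ha (by omega)) hx,
    h'.res.componentGenFun_eq (h1.res hb (by omega)) (h2.res hb (by omega)) hy]

end IsAlternatingPath

end SignedColoredGraph

section WordPatterns

theorem strictMono_or_strictAnti_of_ordSign_ne {α : Type*} [LinearOrder α] {l m s t r : α}
    (hm : m ∈ Set.uIoo s t) (hnodup : [l, m, s, t, r].Nodup)
    (hl : ordSign l m ≠ ordSign l s) (hr : ordSign t r ≠ ordSign m r) :
    StrictMono ![s, l, m, r, t] ∨ StrictAnti ![s, l, m, r, t] := by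
  have hl' : l ∈ Set.uIoo m s := by
    unfold ordSign at hl
    rw [mem_uIoo_iff]
    grind
  have hr' : r ∈ Set.uIoo t m := by
    unfold ordSign at hr
    rw [mem_uIoo_iff]
    grind
  rw [mem_uIoo_iff] at hm hl' hr'
  rcases hm with ⟨hsm, hmt⟩ | ⟨htm, hms⟩
  · have hchain : s < l ∧ l < m ∧ m < r ∧ r < t := by grind
    exact .inl (Fin.strictMono_iff_lt_succ.2 (by simpa [Fin.forall_fin_succ] using hchain))
  · have hchain : l < s ∧ m < l ∧ r < m ∧ t < r := by grind
    exact .inr (Fin.strictAnti_iff_succ_lt.2 (by simpa [Fin.forall_fin_succ] using hchain))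

/-- A sufficient condition, in terms of words, for an edge of color `j + 2` that joins `p` and `q`
to extend to an alternating path whose two other colored steps have color `i + 2`. -/
def IsPathPattern (i j : ℕ) (p q : List (Fin 5)) : Prop :=
  squareMoves i p ≠ [] ∧ (∀ p₁ ∈ squareMoves i p, squareMoves j p₁ = []) ∧
    squareMoves i q ≠ [] ∧ ∀ p₄ ∈ squareMoves i q, squareMoves j p₄ ≠ [] ∧
      ∀ p₅ ∈ squareMoves j p₄, p₅ = q ∨ squareMoves i p₅ = []

instance (i j : ℕ) (p q : List (Fin 5)) : Decidable (IsPathPattern i j p q) := by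
  unfold IsPathPattern
  infer_instance

end WordPatterns

namespace D0Graph

variable {N n : ℕ} (G : D0Graph N n)

theorem exists_isAlternatingPath {u t : List (Fin N)} {ℓ : Fin 5 → Fin N}
    (hℓ : StrictMono ℓ ∨ StrictAnti ℓ) {i j : ℕ} {x y : G.verts} {p q : List (Fin 5)}
    (hi : i ≤ 2) (hj : j ≤ 2) (hp : p.length = 5) (hx : x.1 = embedWord u ℓ t p)
    (hy : y.1 = embedWord u ℓ t q) (hxy : (G.edge (u.length + j + 2)).Adj x y)
    (hpq : IsPathPattern i j p q) :
    ∃ x₁ x₄ x₅, G.toSignedColoredGraph.IsAlternatingPath (u.length + i + 2) (u.length + j + 2)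
      x₁ x y x₄ x₅ := by
  obtain ⟨hpi, hp₁, hqi, hp₄⟩ := hpq
  have hlen : ∀ {k : ℕ} {r r' : List (Fin 5)}, r' ∈ squareMoves k r → r.length = 5 →
      r'.length = 5 := fun h hr => (perm_of_mem_squareMoves h).length_eq.trans hr
  have hend : ∀ {k : ℕ} {z : G.verts} {r : List (Fin 5)}, k ≤ 2 → r.length = 5 →
      z.1 = embedWord u ℓ t r → squareMoves k r = [] →
      ¬ G.toSignedColoredGraph.AdmitsNeighbor (u.length + k + 2) z := by
    rintro k z r hk hr hz hnil ⟨z', hzz'⟩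
    obtain ⟨r', hr', -⟩ := G.exists_mem_squareMoves_of_adj_embedWord hℓ (by omega) hz hzz'
    exact List.not_mem_nil (hnil ▸ hr')
  obtain ⟨q', hq', hyq'⟩ := G.exists_mem_squareMoves_of_adj_embedWord hℓ (by omega) hx hxy
  obtain rfl : q' = q := embedWord_injective (hℓ.elim (·.injective) (·.injective))
    (hyq'.symm.trans hy)
  have hq := hlen hq' hp
  obtain ⟨x₁, hx₁, p₁, hp₁', hxp₁⟩ := G.exists_adj_embedWord hℓ (k := i) (by omega) hx hpi
  obtain ⟨x₄, hx₄, p₄, hp₄', hxp₄⟩ := G.exists_adj_embedWord hℓ (k := i) (by omega) hy hqi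
  have hlen₄ := hlen hp₄' hq
  obtain ⟨x₅, hx₅, p₅, hp₅', hxp₅⟩ :=
    G.exists_adj_embedWord hℓ (k := j) (by omega) hxp₄ (hp₄ p₄ hp₄').1
  have hleft := hend hj (hlen hp₁' hp) hxp₁ (hp₁ p₁ hp₁')
  refine ⟨x₁, x₄, x₅, hx₁.symm, hxy, hx₄, hx₅, hleft, ?_⟩
  rcases (hp₄ p₄ hp₄').2 p₅ hp₅' with rfl | hnil
  · obtain rfl : x₅ = y := Subtype.ext (hxp₅.trans hy.symm)
    obtain rfl : x₄ = x := G.eq_of_adj hx₅.symm hxy.symm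
    obtain rfl : x₁ = x₅ := G.eq_of_adj hx₁ hx₄.symm
    exact (hleft ⟨_, hxy.symm⟩).elim
  · exact hend hi (hlen hp₅' hlen₄) hxp₅ hnil

theorem exists_eq_embedWord_of_sgn_ne {u w : List (Fin N)} {l m r s t : Fin N} {x y : G.verts}
    (hm : m ∈ Set.uIoo s t) (hx : x.1 = u ++ l :: m :: s :: t :: r :: w)
    (hy : y.1 = u ++ l :: s :: t :: m :: r :: w)
    (hleft : G.toSignedColoredGraph.sgn x (u.length + 1) ≠
      G.toSignedColoredGraph.sgn y (u.length + 1))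
    (hright : G.toSignedColoredGraph.sgn x (u.length + 4) ≠
      G.toSignedColoredGraph.sgn y (u.length + 4)) :
    ∃ ℓ : Fin 5 → Fin N, (StrictMono ℓ ∨ StrictAnti ℓ) ∧
      x.1 = embedWord u ℓ w [1, 2, 0, 4, 3] ∧ y.1 = embedWord u ℓ w [1, 0, 4, 2, 3] := by
  have hnodup : [l, m, s, t, r].Nodup := (G.nodup x.1 x.2).sublist <|
    hx ▸ (List.prefix_append [l, m, s, t, r] w).sublist.trans (List.sublist_append_right u _)
  rw [G.sgn_eq_ordSign x hx rfl, G.sgn_eq_ordSign y hy rfl] at hleft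
  rw [G.sgn_eq_ordSign x (p := u ++ [l, m, s]) (by simpa using hx) (by simp),
    G.sgn_eq_ordSign y (p := u ++ [l, s, t]) (by simpa using hy) (by simp)] at hright
  exact ⟨![s, l, m, r, t], strictMono_or_strictAnti_of_ordSign_ne hm hnodup hleft hright,
    by simpa [embedWord] using hx, by simpa [embedWord] using hy⟩

theorem exists_embedWord_of_sgn_ne {k : ℕ} {x y : G.verts} (hk : k + 4 < n)
    (hxy : (G.edge (k + 3)).Adj x y)
    (hleft : G.toSignedColoredGraph.sgn x (k + 1) ≠ G.toSignedColoredGraph.sgn y (k + 1))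
    (hright : G.toSignedColoredGraph.sgn x (k + 4) ≠ G.toSignedColoredGraph.sgn y (k + 4)) :
    ∃ (u t : List (Fin N)) (ℓ : Fin 5 → Fin N), u.length = k ∧ (StrictMono ℓ ∨ StrictAnti ℓ) ∧
      (x.1 = embedWord u ℓ t [1, 2, 0, 4, 3] ∧ y.1 = embedWord u ℓ t [1, 0, 4, 2, 3] ∨
        y.1 = embedWord u ℓ t [1, 2, 0, 4, 3] ∧ x.1 = embedWord u ℓ t [1, 0, 4, 2, 3]) := by
  obtain ⟨v, w, m, s, t, hm, hv, hx, hy⟩ := mem_squareMoves_iff.1 (G.mem_squareMoves_of_adj hxy)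
  replace hv : v.length = k + 1 := hv
  obtain ⟨u, l, rfl⟩ : ∃ u l, v = u ++ [l] :=
    ⟨_, _, (List.dropLast_append_getLast (List.ne_nil_of_length_pos (by omega))).symm⟩
  obtain ⟨r, w, rfl⟩ : ∃ r w', w = r :: w' := by
    refine List.exists_cons_of_length_pos ?_
    have hlx : x.1.length = k + 4 + w.length := by
      rcases hx with hx | hx <;> simp only [hx, List.length_append, List.length_cons] at hv ⊢ <;>
        omega
    have := G.length_eq x.1 x.2
    omega
  obtain rfl : u.length = k := by simpa using hv
  simp only [List.append_assoc, List.cons_append, List.nil_append] at hx hy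
  rcases hx with hx | hx <;> rcases hy with hy | hy
  · exact absurd ((G.sgn_eq_ordSign x hx rfl).trans (G.sgn_eq_ordSign y hy rfl).symm) hleft
  · obtain ⟨ℓ, hℓ, h⟩ := G.exists_eq_embedWord_of_sgn_ne hm hx hy hleft hright
    exact ⟨u, w, ℓ, rfl, hℓ, .inl h⟩
  · obtain ⟨ℓ, hℓ, h⟩ := G.exists_eq_embedWord_of_sgn_ne (Set.uIoo_comm s t ▸ hm) hy hx
      hleft.symm hright.symm
    exact ⟨u, w, ℓ, rfl, hℓ, .inr h⟩
  · have hx' := G.sgn_eq_ordSign x (i := u.length + 4) (p := u ++ [l, t, s]) (by simpa using hx)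
      (by simp)
    have hy' := G.sgn_eq_ordSign y (i := u.length + 4) (p := u ++ [l, s, t]) (by simpa using hy)
      (by simp)
    exact absurd (hx'.trans hy'.symm) hright

theorem componentGenFun_res_eq {u t : List (Fin N)} {ℓ : Fin 5 → Fin N}
    (hℓ : StrictMono ℓ ∨ StrictAnti ℓ) {x y : G.verts}
    (hx : x.1 = embedWord u ℓ t [1, 2, 0, 4, 3]) (hy : y.1 = embedWord u ℓ t [1, 0, 4, 2, 3])
    (hxy : (G.edge (u.length + 3)).Adj x y) :
    (G.toSignedColoredGraph.res (u.length + 1) 4).componentGenFun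
        ((G.toSignedColoredGraph.res (u.length + 1) 4).graph.connectedComponentMk y) =
      (G.toSignedColoredGraph.res (u.length + 2) 4).componentGenFun
        ((G.toSignedColoredGraph.res (u.length + 2) 4).graph.connectedComponentMk x) := by
  obtain ⟨x₁, x₄, x₅, hpath⟩ := G.exists_isAlternatingPath hℓ (i := 0) (j := 1)
    (by decide) (by decide) rfl hx hy hxy (by decide)
  obtain ⟨y₁, y₄, y₅, hpath'⟩ := G.exists_isAlternatingPath hℓ (i := 2) (j := 1)
    (by decide) (by decide) rfl hy hx hxy.symm (by decide)
  have hsign : G.toSignedColoredGraph.sgn x (u.length + 2) =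
      G.toSignedColoredGraph.sgn y (u.length + 1) := by
    rw [G.sgn_embedWord hx (k := 1) (by simp), G.sgn_embedWord hy (k := 0) (by simp)]
    rcases hℓ with hℓ | hℓ
    · exact (if_neg (hℓ (by decide)).not_ge).trans (if_neg (hℓ (by decide)).not_ge).symm
    · exact (if_pos (hℓ (by decide)).le).trans (if_pos (hℓ (by decide)).le).symm
  exact hpath.componentGenFun_res_congr G.axiom1 G.axiom2 hpath'.symm (by omega) (by omega)
    hsign.symm

theorem axiom4a : G.toSignedColoredGraph.Axiom4a := by
  intro i x y hi hin hxy _ hleft hright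
  obtain ⟨k, rfl⟩ := Nat.exists_eq_add_of_le' hi
  have hcomp : ∀ a s, 2 ≤ s → s < 4 → s + a - 1 = k + 3 →
      (G.toSignedColoredGraph.res a 4).graph.connectedComponentMk x =
        (G.toSignedColoredGraph.res a 4).graph.connectedComponentMk y := fun a s hs hs4 hk =>
    SignedColoredGraph.connectedComponentMk_res_eq_of_adj _ hs hs4 (hk ▸ hxy)
  have hcomp₁ := hcomp (k + 1) 3 (by decide) (by decide) (by omega)
  have hcomp₂ := hcomp (k + 2) 2 (by decide) (by decide) (by omega)
  obtain ⟨u, t, ℓ, rfl, hℓ, ⟨hx, hy⟩ | ⟨hy, hx⟩⟩ :=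
    G.exists_embedWord_of_sgn_ne hin hxy hleft hright
  · exact (congrArg _ hcomp₁).trans (G.componentGenFun_res_eq hℓ hx hy hxy)
  · exact (G.componentGenFun_res_eq hℓ hy hx hxy.symm).trans (congrArg _ hcomp₂.symm)

end D0Graph

theorem theoremt (N n : ℕ) (G : D0Graph N n) :
    (G.toSignedColoredGraph.Axiom1 ∧ G.toSignedColoredGraph.Axiom2 ∧
      G.toSignedColoredGraph.Axiom3 ∧ G.toSignedColoredGraph.Axiom4a ∧
      G.toSignedColoredGraph.LSP 4 ∧ G.toSignedColoredGraph.LSP 5) ∧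
    (G.toSignedColoredGraph.IsDGraph ↔
      G.toSignedColoredGraph.Axiom4b ∧ G.toSignedColoredGraph.Axiom5) := by
  refine ⟨⟨G.axiom1, G.axiom2, G.axiom3, G.axiom4a, G.lsp_four, G.lsp_five⟩, ?_, ?_⟩
  · rintro ⟨-, -, -, -, h4b, h5, -, -⟩
    exact ⟨h4b, h5⟩
  · rintro ⟨h4b, h5⟩
    exact ⟨G.axiom1, G.axiom2, G.axiom3, G.axiom4a, h4b, h5, G.lsp_four, G.lsp_five⟩
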